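/- Let $n\in\mathbb N$, $r,Q>0$, $p>2n$ and $\beta\in(\tfrac12,\,1-\tfrac np)$. Write $B(x,s)$ for the open Euclidean ball in $\mathbb R^n$ and $B_\infty(x,s)=x+(-s,s)^n$ for the open ball of the maximum norm. A mollification kernel is a smooth function $\varphi:\mathbb R^n\to[0,1]$, supported on $[-1,1]^n$, with $\varphi(0)=\int\varphi=1$; put $\varphi_t(x)=t^{-n}\varphi(x/t)$ and $P_tf=\varphi_t*f$ (componentwise for tensors; a function on $B(0,r)$ is extended by zero). For a smooth Riemannian manifold $(M,g)$ of dimension $n$ with base point $x_0$ and a chart $\psi:(B(0,r),0)\to(M,x_0)$ of the smooth atlas (written as a parametrization), let $g_{\cdot\cdot}=\psi^*g$ be the coordinate metric on $B(0,r)$. We write $\|\psi\|_{W^{2,p},r}\le Q$ if $$e^{-2Q}|v|^2\le g_{kl}(x)v^kv^l\le e^{2Q}|v|^2\quad(x\in B(0,r),\ v\in\mathbb R^n)\qquad\text{and}\qquad r^{k-n/p}\,\|\nabla^k g_{\cdot\cdot}\|_{L^p(B(0,r))}\le Q\quad(k=0,1,2),$$ where $|v|$ is the Euclidean norm of $v$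 and $\nabla^kg_{\cdot\cdot}$ is the vector of all $k$-th partial derivatives of the components, measured pointwise in the maximum norm. For a metric $h$ in coordinates with curvature components $R^\rho{}_{\sigma\mu\nu}$ and $w=(w_1,w_2,w_3,w_4)$ consisting of three vectors and one covector of $\mathbb R^n$, let $\mathrm{Riem}_h(y)(w)=R^\rho{}_{\sigma\mu\nu}(y)\,w_1^\mu w_2^\nu w_3^\sigma w_{4,\rho}$. Then there are $T\in(0,\tfrac r2)$ and $C>0$, depending only on $n,p,r,Q,\beta$, such that for every mollification kernel $\varphi$, every pointed smooth Riemannian manifold $(M,g,x_0)$ of dimension $n$, every chart $\psi$ as above with $\|\psi\|_{W^{2,p},r}\le Q$ and every $t\in(0,T]$, the tensor $P_t(g_{\cdot\cdot})$ is a smooth Riemannian metric on $B(0,\tfrac r2)$, and for every bounded smooth section $v$ of $T^{3,1}B(0,r)$, regarded as a map $v:B(0,r)\to\mathbb R^{4n}$ with the maximum norm on $\mathbb R^{4n}$, and every $x\in B(0,\tfrac r2)$, $$\mathrm{Riem}_{P_t(g_{\cdot\cdot})}(x)(v(x))-\sup_{y\in B_\infty(x,t)}\mathrm{Riem}_{g_{\cdot\cdot}}(y)(v(x))\le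 C\,\|v\|_{L^\infty}^4\,t^\beta,$$ where the supremum is finite and $v(x)$ is moved to the point $y$ by the canonical identification $T_x\mathbb R^n=T_y\mathbb R^n$. If $\varphi$ is moreover supported in the closed Euclidean unit ball, the same holds with the Euclidean ball $B(x,t)$ in place of $B_\infty(x,t)$. -/

import Mathlib

open Set Filter Topology MeasureTheory Metric
open scoped ENNReal Manifold ContDiff

noncomputable section

namespace MollifiedCurvature

/-- `ℝⁿ` with the Euclidean norm; its balls are Euclidean balls. -/
abbrev Eucl (n : ℕ) : Type := EuclideanSpace ℝ (Fin n)

/-- The `i`-th standard basis vector of `ℝⁿ`. -/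
def stdVec {n : ℕ} (i : Fin n) : Eucl n := EuclideanSpace.single i (1 : ℝ)

/-- The open ball of radius `t` around `x` for the maximum norm, i.e. `x + (-t, t)ⁿ`. -/
def openCube {n : ℕ} (x : Eucl n) (t : ℝ) : Set (Eucl n) := {y | ∀ i, |y i - x i| < t}

/-! ### Tensors in coordinates

A (0,2)-tensor field on a subset of `ℝⁿ` is given by its matrix of components. -/

/-- The partial derivative `∂ᵢ f (x)`. -/
def partialDeriv {n : ℕ} (i : Fin n) (f : Eucl n → ℝ) (x : Eucl n) : ℝ :=
  fderiv ℝ f x (stdVec i)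

/-- `Γⁱₖₗ = ½ gⁱᵐ (∂ₗ gₘₖ + ∂ₖ gₘₗ - ∂ₘ gₖₗ)`. -/
def christoffel {n : ℕ} (G : Eucl n → Matrix (Fin n) (Fin n) ℝ) (i k l : Fin n)
    (x : Eucl n) : ℝ :=
  (1 / 2 : ℝ) * ∑ m, (G x)⁻¹ i m *
    (partialDeriv l (fun y => G y m k) x + partialDeriv k (fun y => G y m l) x
      - partialDeriv m (fun y => G y k l) x)

/-- The components `R^ρ_{σμν}` of the Riemannian curvature tensor of `G`:
`∂_μ Γ^ρ_{νσ} - ∂_ν Γ^ρ_{μσ} + Γ^ρ_{μκ} Γ^κ_{νσ} - Γ^ρ_{νκ} Γ^κ_{μσ}`. -/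
def riemComp {n : ℕ} (G : Eucl n → Matrix (Fin n) (Fin n) ℝ) (ρ σ μ ν : Fin n)
    (x : Eucl n) : ℝ :=
  partialDeriv μ (christoffel G ρ ν σ) x - partialDeriv ν (christoffel G ρ μ σ) x
    + ∑ κ, (christoffel G ρ μ κ x * christoffel G κ ν σ x
      - christoffel G ρ ν κ x * christoffel G κ μ σ x)

/-- `Riem_G(x)(w) = w₃ (R(w₀, w₁) w₂)` for tangent vectors `w₀, w₁, w₂` and a covector `w₃`, all
given by their components in `ℝⁿ`. -/
def riem {n : ℕ} (G : Eucl n → Matrix (Fin n) (Fin n) ℝ) (x : Eucl n)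
    (w : Fin 4 → Fin n → ℝ) : ℝ :=
  ∑ ρ, ∑ σ, ∑ μ, ∑ ν, riemComp G ρ σ μ ν x * w 0 μ * w 1 ν * w 2 σ * w 3 ρ

/-- All partial derivatives of order `k` of all components of `G`. The norm of this function space
over finite index sets is the maximum norm. -/
def nablaPow {n : ℕ} (k : ℕ) (G : Eucl n → Matrix (Fin n) (Fin n) ℝ) (x : Eucl n) :
    Fin n → Fin n → (Fin k → Fin n) → ℝ :=
  fun a b I => iteratedFDeriv ℝ k (fun y => G y a b) x (fun m => stdVec (I m))

/-! ### Mollification -/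

/-- A mollification kernel: a smooth function `φ : ℝⁿ → [0,1]` supported on `[-1,1]ⁿ` with
`φ(0) = ∫ φ = 1`. -/
structure IsMollificationKernel {n : ℕ} (φ : Eucl n → ℝ) : Prop where
  contDiff : ContDiff ℝ ∞ φ
  nonneg : ∀ x, 0 ≤ φ x
  le_one : ∀ x, φ x ≤ 1
  support_subset : Function.support φ ⊆ {x | ∀ i, |x i| ≤ 1}
  map_zero : φ 0 = 1
  integral_eq_one : ∫ x, φ x = 1

/-- `φ_t(x) = t⁻ⁿ φ(x/t)`. -/
def scaledKernel {n : ℕ} (φ : Eucl n → ℝ) (t : ℝ) (x : Eucl n) : ℝ :=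
  (t ^ n)⁻¹ * φ (t⁻¹ • x)

/-- `P_t f = φ_t * f`. -/
def mollify {n : ℕ} (φ : Eucl n → ℝ) (t : ℝ) (f : Eucl n → ℝ) : Eucl n → ℝ :=
  convolution (scaledKernel φ t) f (ContinuousLinearMap.lsmul ℝ ℝ) volume

/-- The componentwise mollification `P_t G` of a tensor field `G` on `B(0,r)`, which is extended
by zero outside of the ball. -/
def mollifyMetric {n : ℕ} (φ : Eucl n → ℝ) (r t : ℝ) (G : Eucl n → Matrix (Fin n) (Fin n) ℝ)
    (x : Eucl n) : Matrix (Fin n) (Fin n) ℝ :=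
  Matrix.of fun a b => mollify φ t ((ball (0 : Eucl n) r).indicator fun y => G y a b) x

/-! ### Charts and chart norms -/

section Manifold

variable {n : ℕ} {M : Type*} [TopologicalSpace M] [ChartedSpace (Eucl n) M]
  [IsManifold 𝓘(ℝ, Eucl n) ∞ M]

/-- Smooth Riemannian metrics on the `n`-dimensional smooth manifold `M`. -/
abbrev SmoothMetric (n : ℕ) (M : Type*) [TopologicalSpace M] [ChartedSpace (Eucl n) M]
    [IsManifold 𝓘(ℝ, Eucl n) ∞ M] : Type _ :=
  Bundle.ContMDiffRiemannianMetric (IB := 𝓘(ℝ, Eucl n)) (n := ∞) (F := Eucl n)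
    (E := fun x : M => TangentSpace 𝓘(ℝ, Eucl n) x)

/-- The components of `ψ^* g`: `g(ψ x)(∂ᵢψ(x), ∂ⱼψ(x))`. -/
def pullbackMetric (g : SmoothMetric n M) (ψ : Eucl n → M) (x : Eucl n) :
    Matrix (Fin n) (Fin n) ℝ :=
  Matrix.of fun i j =>
    g.inner (ψ x) (mfderiv 𝓘(ℝ, Eucl n) 𝓘(ℝ, Eucl n) ψ x (stdVec i))
      (mfderiv 𝓘(ℝ, Eucl n) 𝓘(ℝ, Eucl n) ψ x (stdVec j))

/-- `ψ : (B(0,r), 0) → (M, x₀)` is a pointed chart compatible with the smooth atlas of `M`; the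
chart is written as a parametrization, so it is its inverse that belongs to the atlas. -/
structure IsPointedChart (r : ℝ) (x₀ : M) (ψ : OpenPartialHomeomorph (Eucl n) M) : Prop where
  source_eq : ψ.source = ball (0 : Eucl n) r
  map_zero : ψ 0 = x₀
  mem_atlas : ψ.symm ∈ IsManifold.maximalAtlas 𝓘(ℝ, Eucl n) ∞ M

end Manifold

/-- For the coordinate metric `G` on `B(0,r)` of a chart `ψ`, this says `‖ψ‖_{W^{m,p},r} ≤ Q`: the
chart norm is the least `Q ≥ 0` with `e^{-2Q}|v|² ≤ G(x)(v,v) ≤ e^{2Q}|v|²` on `B(0,r)` and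
`r^{k-n/p} ‖∇ᵏ G‖_{Lᵖ(B(0,r))} ≤ Q` for `k = 0, …, m`. All conditions persist when `Q` grows. -/
structure SobolevChartNormLE {n : ℕ} (m : ℕ) (p r Q : ℝ)
    (G : Eucl n → Matrix (Fin n) (Fin n) ℝ) : Prop where
  lower : ∀ x ∈ ball (0 : Eucl n) r, ∀ v : Eucl n,
    Real.exp (-2 * Q) * ‖v‖ ^ 2 ≤ ∑ k, ∑ l, G x k l * v k * v l
  upper : ∀ x ∈ ball (0 : Eucl n) r, ∀ v : Eucl n,
    ∑ k, ∑ l, G x k l * v k * v l ≤ Real.exp (2 * Q) * ‖v‖ ^ 2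
  sobolev : ∀ k : ℕ, k ≤ m →
    ENNReal.ofReal (r ^ ((k : ℝ) - n / p)) *
      eLpNorm (nablaPow k G) (ENNReal.ofReal p) (volume.restrict (ball (0 : Eucl n) r))
        ≤ ENNReal.ofReal Q

/-- `Riem_{G'}(x)(w) - sup_{y ∈ S} Riem_G(y)(w) ≤ b`, where the supremum is finite. -/
def CurvatureExcessLE {n : ℕ} (G' G : Eucl n → Matrix (Fin n) (Fin n) ℝ) (x : Eucl n)
    (S : Set (Eucl n)) (w : Fin 4 → Fin n → ℝ) (b : ℝ) : Prop :=
  BddAbove ((fun y => riem G y w) '' S) ∧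
    riem G' x w - sSup ((fun y => riem G y w) '' S) ≤ b

end MollifiedCurvature

end

namespace MollifiedCurvature

/-! ### Averages against a probability measure on the unit cube -/

/-! Substituting y = tz turns P_t f(x) into the average of f(x - tz) over a probability measure μ of
density φ, and μ ≤ volume because φ ≤ 1. An average of the numbers Riem_g(y)(w) over points y of the
cube is at most their supremum. So it suffices to bound the difference between Riem of the averaged
metric at x and the average of Riem_g around x, which is a commutator of averaging with the
nonlinear curvature expression.

Averaging commutes with partial derivatives. The curvature is linear in the second derivatives of g,
with coefficients from g⁻¹, plus a polynomial in g⁻¹ and the first derivatives. For the polynomial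
part a pointwise estimate is enough: since n < p, a Morrey argument bounds the first derivatives and
makes them Hölder of exponent 1 - n/p, so each factor moves by O(t^(1-n/p)) over the cube (`Near`).
The second derivatives are only in Lᵖ. There the commutator is the average of (a - A) ∂²g, where a
is an entry of the inverse of the averaged metric and A the same entry of g⁻¹. The factor a - A is
O(t), since g is Lipschitz and uniformly positive, and the average of |∂²g| is O(t^(-n/p)) by
Hölder's inequality and scaling (`avg_abs_le_of_eLpNorm_le`, `Near.avgNear_mul`). The product is
again O(t^(1-n/p)), which is at most O(t^β) for t ≤ 1.

All analysis is done for a compactly supported metric obtained by a cutoff (`exists_metricBounds`).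
`MetricBounds.exists_avgNear_riem` assembles the two kinds of error with a constant independent of
μ, the metric and t. -/

/-- The average of `f` over `x - t z`, where `z` is distributed according to `μ`. -/
noncomputable def avg {n : ℕ} (μ : Measure (Eucl n)) (t : ℝ) (f : Eucl n → ℝ) (x : Eucl n) : ℝ :=
  ∫ z, f (x - t • z) ∂μ

lemma sub_smul_mem_openCube {n : ℕ} {x z : Eucl n} {t : ℝ} (ht : 0 < t)
    (hz : z ∈ openCube (0 : Eucl n) 1) : x - t • z ∈ openCube x t := by
  intro i
  have := hz i
  simp only [PiLp.zero_apply, sub_zero] at this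
  simp only [PiLp.sub_apply, PiLp.smul_apply, smul_eq_mul, sub_sub_cancel_left, abs_neg, abs_mul,
    abs_of_pos ht]
  nlinarith

lemma mem_openCube_self {n : ℕ} (x : Eucl n) {t : ℝ} (ht : 0 < t) : x ∈ openCube x t := by
  intro i; simpa using ht

lemma openCube_mono {n : ℕ} (x : Eucl n) {s t : ℝ} (h : s ≤ t) : openCube x s ⊆ openCube x t :=
  fun _ hy i => (hy i).trans_le h

lemma isOpen_openCube {n : ℕ} (x : Eucl n) (t : ℝ) : IsOpen (openCube x t) := by
  have : openCube x t = ⋂ i, {y : Eucl n | |y i - x i| < t} := by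
    ext y; simp [openCube]
  rw [this]
  exact isOpen_iInter_of_finite fun i => isOpen_lt (by fun_prop) continuous_const

/-- Triangle inequality along the coordinate directions. The crude factor n in place of √n only
influences the choice of T. -/
lemma dist_le_of_mem_openCube {n : ℕ} {x y : Eucl n} {t : ℝ} (hy : y ∈ openCube x t) :
    dist y x ≤ n * t := by
  rw [dist_eq_norm]
  have h1 : y - x = ∑ i, (y i - x i) • stdVec i := by
    ext j
    simp [stdVec, Finset.sum_apply, Pi.single_apply]
  calc ‖y - x‖ ≤ ∑ i, ‖(y i - x i) • (stdVec i : Eucl n)‖ := by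
        rw [h1]; exact norm_sum_le _ _
    _ ≤ ∑ _i : Fin n, t := by
        refine Finset.sum_le_sum fun i _ => ?_
        rw [norm_smul, stdVec, PiLp.norm_single]
        simpa using (hy i).le
    _ = n * t := by simp

lemma convex_openCube {n : ℕ} (x : Eucl n) (t : ℝ) : Convex ℝ (openCube x t) := by
  intro y hy z hz a b ha hb hab i
  have h : (a • y + b • z) i - x i = a * (y i - x i) + b * (z i - x i) := by
    have : x i = a * x i + b * x i := by rw [← add_mul, hab, one_mul]
    simp only [PiLp.add_apply, PiLp.smul_apply, smul_eq_mul]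
    linarith
  rw [h]
  refine (abs_add_le _ _).trans_lt ?_
  rw [abs_mul, abs_mul, abs_of_nonneg ha, abs_of_nonneg hb]
  have h1 := hy i
  have h2 := hz i
  rcases ha.eq_or_lt with h0 | h0
  · have : b = 1 := by linarith
    subst this; rw [← h0]; linarith
  · calc a * |y i - x i| + b * |z i - x i| < a * t + b * t :=
        add_lt_add_of_lt_of_le (mul_lt_mul_of_pos_left h1 h0) (mul_le_mul_of_nonneg_left h2.le hb)
      _ = t := by rw [← add_mul, hab, one_mul]

lemma fderiv_eq_sum_partialDeriv {n : ℕ} (f : Eucl n → ℝ) (x v : Eucl n) :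
    fderiv ℝ f x v = ∑ i, v i * partialDeriv i f x := by
  have h1 : v = ∑ i, v i • stdVec i := by
    ext j
    simp [stdVec, Finset.sum_apply, Pi.single_apply]
  conv_lhs => rw [h1]
  simp [partialDeriv]

lemma abs_fderiv_le {n : ℕ} (f : Eucl n → ℝ) (x v : Eucl n) {s : ℝ} (hv : ∀ i, |v i| ≤ s) :
    |fderiv ℝ f x v| ≤ s * ∑ i, |partialDeriv i f x| := by
  rw [fderiv_eq_sum_partialDeriv, Finset.mul_sum]
  refine (Finset.abs_sum_le_sum_abs _ _).trans (Finset.sum_le_sum fun i _ => ?_)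
  rw [abs_mul]
  exact mul_le_mul_of_nonneg_right (hv i) (abs_nonneg _)

lemma contDiff_partialDeriv {n : ℕ} {f : Eucl n → ℝ} (hf : ContDiff ℝ ∞ f) (i : Fin n) :
    ContDiff ℝ ∞ (partialDeriv i f) :=
  (hf.fderiv_right (m := ∞) (by simp)).clm_apply contDiff_const

lemma hasCompactSupport_partialDeriv {n : ℕ} {f : Eucl n → ℝ} (hf : HasCompactSupport f)
    (i : Fin n) : HasCompactSupport (partialDeriv i f) := by
  have := hf.fderiv (𝕜 := ℝ)
  exact this.comp_left (g := fun L : Eucl n →L[ℝ] ℝ => L (stdVec i)) (by simp)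

lemma abs_avg_le {n : ℕ} {μ : Measure (Eucl n)} {f : Eucl n → ℝ} (t : ℝ) (x : Eucl n) :
    |avg μ t f x| ≤ avg μ t (fun y => |f y|) x := abs_integral_le_integral_abs

/-! ### Derivatives, Lᵖ bounds and the Morrey estimate for averages -/

section Average

variable {n : ℕ} {μ : Measure (Eucl n)} [IsProbabilityMeasure μ]

lemma integrable_comp_sub_smul {f : Eucl n → ℝ} (hf : Continuous f) (hfc : HasCompactSupport f)
    (t : ℝ) (x : Eucl n) : Integrable (fun z => f (x - t • z)) μ := by
  obtain ⟨C, hC⟩ := hfc.exists_bound_of_continuous hf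
  exact Integrable.of_bound (by fun_prop) C (Eventually.of_forall fun z => hC _)

/-- Differentiation under the integral sign. The derivative falls on f, so μ needs no density. -/
lemma hasFDerivAt_avg {f : Eucl n → ℝ} (hf : ContDiff ℝ ∞ f) (hfc : HasCompactSupport f)
    (t : ℝ) (x : Eucl n) :
    HasFDerivAt (avg μ t f) (∫ z, fderiv ℝ f (x - t • z) ∂μ) x := by
  have hd : Continuous (fderiv ℝ f) := hf.continuous_fderiv (by simp)
  obtain ⟨C, hC⟩ := (hfc.fderiv (𝕜 := ℝ)).exists_bound_of_continuous hd
  have hc := hf.continuous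
  refine hasFDerivAt_integral_of_dominated_of_fderiv_le (s := univ) (bound := fun _ => C)
    (F' := fun x z => fderiv ℝ f (x - t • z)) univ_mem
    (Eventually.of_forall fun y => Continuous.aestronglyMeasurable (by fun_prop))
    (integrable_comp_sub_smul hf.continuous hfc t x)
    (Continuous.aestronglyMeasurable (by fun_prop))
    (Eventually.of_forall fun z y _ => hC _) (integrable_const C)
    (Eventually.of_forall fun z y _ => ?_)
  have h1 : HasFDerivAt f (fderiv ℝ f (y - t • z)) (y - t • z) :=
    (hf.differentiable (by simp) _).hasFDerivAt
  exact h1.comp y ((hasFDerivAt_id y).sub_const (t • z))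

lemma partialDeriv_avg {f : Eucl n → ℝ} (hf : ContDiff ℝ ∞ f) (hfc : HasCompactSupport f)
    (t : ℝ) (i : Fin n) : partialDeriv i (avg μ t f) = avg μ t (partialDeriv i f) := by
  funext x
  have hd : Continuous (fderiv ℝ f) := hf.continuous_fderiv (by simp)
  obtain ⟨C, hC⟩ := (hfc.fderiv (𝕜 := ℝ)).exists_bound_of_continuous hd
  have hi : Integrable (fun z => fderiv ℝ f (x - t • z)) μ :=
    Integrable.of_bound (by fun_prop) C (Eventually.of_forall fun z => hC _)
  rw [partialDeriv, (hasFDerivAt_avg hf hfc t x).fderiv,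
    ContinuousLinearMap.integral_apply hi]
  rfl

lemma avg_sum_abs {f : Eucl n → ℝ} (hf : ContDiff ℝ ∞ f) (hfc : HasCompactSupport f)
    (t : ℝ) (x : Eucl n) :
    avg μ t (fun y => ∑ i, |partialDeriv i f y|) x
      = ∑ i, avg μ t (fun y => |partialDeriv i f y|) x := by
  unfold avg
  refine integral_finsetSum _ fun i _ => ?_
  exact (integrable_comp_sub_smul (contDiff_partialDeriv hf i).continuous
    (hasCompactSupport_partialDeriv hfc i) t x).abs

/-- On a probability space the L¹ norm is at most the Lᵖ norm; then μ ≤ volume, and the change of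
variables y = x - tz, of Jacobian tⁿ, produces the factor t^(-n/p). -/
lemma avg_abs_le_of_eLpNorm_le (hμ : μ ≤ volume) (hc : ∀ᵐ z ∂μ, z ∈ openCube (0 : Eucl n) 1)
    {p : ℝ} (hp : 1 ≤ p) {t : ℝ} (ht : 0 < t) {x : Eucl n} {U : Set (Eucl n)}
    (hU : MeasurableSet U) (hx : openCube x t ⊆ U) {f : Eucl n → ℝ} (hf : Continuous f) {K : ℝ}
    (hK : 0 ≤ K) (h : eLpNorm f (ENNReal.ofReal p) (volume.restrict U) ≤ ENNReal.ofReal K) :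
    avg μ t (fun y => |f y|) x ≤ t ^ (-(n / p : ℝ)) * K := by
  set T : Eucl n → Eucl n := fun z => x - t • z with hT
  have hTc : Continuous T := by fun_prop
  have hm : Measure.map T volume = ENNReal.ofReal ((t ^ n)⁻¹) • (volume : Measure (Eucl n)) := by
    have h1 : T = (fun y => x - y) ∘ (fun z => t • z) := rfl
    rw [h1, ← Measure.map_map (by fun_prop) (by fun_prop), Measure.map_addHaar_smul _ ht.ne',
      Measure.map_smul, (Measure.measurePreserving_sub_left volume x).map_eq]
    simp [abs_of_pos ht]
  -- Only sample points inside U carry mass, so a norm over U suffices although f lives on the whole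
  -- space.
  have hle : μ ≤ volume.restrict (T ⁻¹' U) := by
    have : ∀ᵐ z ∂μ, z ∈ T ⁻¹' U := by
      filter_upwards [hc] with z hz
      exact hx (sub_smul_mem_openCube ht hz)
    rw [← Measure.restrict_eq_self_of_ae_mem this]
    exact Measure.restrict_mono subset_rfl hμ
  have hp0 : (0 : ℝ) < p := by linarith
  have h2 : eLpNorm (f ∘ T) (ENNReal.ofReal p) (volume.restrict (T ⁻¹' U))
      ≤ ENNReal.ofReal (t ^ (-(n / p : ℝ)) * K) := by
    rw [← eLpNorm_map_measure hf.aestronglyMeasurable hTc.aemeasurable,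
      ← Measure.restrict_map hTc.measurable hU, hm, Measure.restrict_smul,
      eLpNorm_smul_measure_of_ne_top ENNReal.ofReal_ne_top]
    have h3 : ENNReal.ofReal ((t ^ n)⁻¹) ^ (1 / ENNReal.ofReal p).toReal
        = ENNReal.ofReal (t ^ (-(n / p : ℝ))) := by
      have h4 : (1 / ENNReal.ofReal p).toReal = 1 / p := by
        simp [ENNReal.toReal_ofReal hp0.le]
      rw [h4, ENNReal.ofReal_rpow_of_pos (by positivity)]
      congr 1
      rw [← Real.rpow_natCast, ← Real.rpow_neg ht.le, ← Real.rpow_mul ht.le]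
      congr 1
      ring
    rw [h3, ENNReal.ofReal_mul (by positivity), smul_eq_mul]
    gcongr
  have h5 : eLpNorm (f ∘ T) 1 μ ≤ ENNReal.ofReal (t ^ (-(n / p : ℝ)) * K) :=
    (eLpNorm_le_eLpNorm_of_exponent_le (by simpa using hp)
      (hf.comp hTc).aestronglyMeasurable).trans ((eLpNorm_mono_measure _ hle).trans h2)
  rw [eLpNorm_one_eq_lintegral_enorm] at h5
  have h6 : avg μ t (fun y => |f y|) x = (∫⁻ z, ‖(f ∘ T) z‖ₑ ∂μ).toReal := by
    rw [← integral_norm_eq_lintegral_enorm (hf.comp hTc).aestronglyMeasurable]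
    rfl
  rw [h6]
  exact ENNReal.toReal_le_of_le_ofReal (by positivity) h5

/-- An average of a function differs from a number by at most the deviation of the function. -/
lemma abs_sub_avg_le (hc : ∀ᵐ z ∂μ, z ∈ openCube (0 : Eucl n) 1) {f : Eucl n → ℝ} {t : ℝ}
    (ht : 0 < t) {x : Eucl n} (hi : Integrable (fun z => f (x - t • z)) μ) {a b : ℝ}
    (h : ∀ y ∈ openCube x t, |a - f y| ≤ b) : |a - avg μ t f x| ≤ b := by
  have h1 : a - avg μ t f x = ∫ z, (a - f (x - t • z)) ∂μ := by
    rw [integral_sub (integrable_const a) hi]; simp [avg]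
  have h2 := norm_integral_le_of_norm_le_const (μ := μ) (f := fun z => a - f (x - t • z)) (C := b)
    (by
      filter_upwards [hc] with z hz
      exact h _ (sub_smul_mem_openCube ht hz))
  rw [h1]
  simpa using h2

/-- The Morrey-type estimate of the error of an average. -/
lemma abs_sub_avg_le_of_eLpNorm_partialDeriv_le (hμ : μ ≤ volume)
    (hc : ∀ᵐ z ∂μ, z ∈ openCube (0 : Eucl n) 1) {p : ℝ} (hp : 1 ≤ p) (hnp : (n : ℝ) < p)
    {t : ℝ} (ht : 0 < t) {x : Eucl n} {U : Set (Eucl n)}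
    (hU : MeasurableSet U) (hx : openCube x t ⊆ U) {f : Eucl n → ℝ} (hf : ContDiff ℝ ∞ f)
    (hfc : HasCompactSupport f) {K : ℝ} (hK : 0 ≤ K)
    (h : ∀ i, eLpNorm (partialDeriv i f) (ENNReal.ofReal p) (volume.restrict U)
      ≤ ENNReal.ofReal K) :
    |f x - avg μ t f x| ≤ n * K / (1 - n / p) * t ^ (1 - n / p : ℝ) := by
  have hp0 : (0 : ℝ) < p := by linarith
  have hα : 0 < 1 - n / p := by
    rw [sub_pos, div_lt_one hp0]; exact hnp
  have hfd : Continuous (fderiv ℝ f) := hf.continuous_fderiv (by simp)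
  have hf0 := hf.continuous
  have hz1 : ∀ z ∈ openCube (0 : Eucl n) 1, ∀ i, |z i| ≤ 1 := fun z hz i => by
    simpa using (hz i).le
  obtain ⟨C, hC⟩ := (hfc.fderiv (𝕜 := ℝ)).exists_bound_of_continuous hfd
  have hC0 : 0 ≤ C := (norm_nonneg _).trans (hC 0)
  -- The average is differentiated in its scale τ; it interpolates between f x at τ = 0 and the
  -- average at τ = t.
  have hder : ∀ τ : ℝ, HasDerivAt (fun τ => avg μ τ f x)
      (∫ z, fderiv ℝ f (x - τ • z) (-z) ∂μ) τ := by
    intro τ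
    refine (hasDerivAt_integral_of_dominated_loc_of_deriv_le (s := univ)
      (bound := fun _ => C * n) (F := fun τ z => f (x - τ • z))
      (F' := fun τ z => fderiv ℝ f (x - τ • z) (-z)) univ_mem
      (Eventually.of_forall fun y => Continuous.aestronglyMeasurable (by fun_prop))
      (integrable_comp_sub_smul hf.continuous hfc τ x)
      (Continuous.aestronglyMeasurable (by fun_prop)) ?_ (integrable_const _)
      (Eventually.of_forall fun z y _ => ?_)).2
    · filter_upwards [hc] with z hz y _
      have h1 := dist_le_of_mem_openCube hz
      rw [dist_zero_right, mul_one] at h1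
      refine (ContinuousLinearMap.le_opNorm _ _).trans ?_
      rw [norm_neg]
      exact mul_le_mul (hC _) h1 (norm_nonneg _) hC0
    · have h1 : HasFDerivAt f (fderiv ℝ f (x - y • z)) (x - y • z) :=
        (hf.differentiable (by simp) _).hasFDerivAt
      have h2 : HasDerivAt (fun y : ℝ => x - y • z) (-z) y := by
        simpa using ((hasDerivAt_id (𝕜 := ℝ) y).smul_const z).const_sub x
      exact h1.comp_hasDerivAt y h2
  -- This bound is integrable at τ = 0 precisely because n < p; its primitive appears in `hB`.
  have hbd : ∀ τ ∈ Ioo 0 t, |∫ z, fderiv ℝ f (x - τ • z) (-z) ∂μ|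
      ≤ n * K * τ ^ (-(n / p : ℝ)) := by
    intro τ hτ
    have h1 : |∫ z, fderiv ℝ f (x - τ • z) (-z) ∂μ|
        ≤ avg μ τ (fun y => ∑ i, |partialDeriv i f y|) x := by
      refine norm_integral_le_of_norm_le (μ := μ)
        (f := fun z => fderiv ℝ f (x - τ • z) (-z))
        (g := fun z => ∑ i, |partialDeriv i f (x - τ • z)|) ?_ ?_
      · exact integrable_finsetSum _ fun i _ =>
          (integrable_comp_sub_smul (contDiff_partialDeriv hf i).continuous
            (hasCompactSupport_partialDeriv hfc i) τ x).abs
      · filter_upwards [hc] with z hz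
        simpa using abs_fderiv_le f (x - τ • z) (-z) (s := 1) (fun i => by simpa using hz1 z hz i)
    refine h1.trans ?_
    rw [avg_sum_abs hf hfc]
    calc ∑ i, avg μ τ (fun y => |partialDeriv i f y|) x
        ≤ ∑ _i : Fin n, τ ^ (-(n / p : ℝ)) * K :=
          Finset.sum_le_sum fun i _ => avg_abs_le_of_eLpNorm_le hμ hc hp hτ.1 hU
            ((openCube_mono x hτ.2.le).trans hx) (contDiff_partialDeriv hf i).continuous hK (h i)
      _ = n * K * τ ^ (-(n / p : ℝ)) := by simp; ring
  have hB : ∀ τ ∈ Ioo 0 t, HasDerivAt (fun τ : ℝ => n * K / (1 - n / p) * τ ^ (1 - n / p : ℝ))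
      (n * K * τ ^ (-(n / p : ℝ))) τ := by
    intro τ hτ
    have := (Real.hasDerivAt_rpow_const (x := τ) (p := 1 - n / p) (Or.inl hτ.1.ne')).const_mul
      (n * K / (1 - n / p))
    refine this.congr_deriv ?_
    rw [show (1 - n / p - 1 : ℝ) = -(n / p) by ring, ← mul_assoc, div_mul_cancel₀ _ hα.ne']
  have hBc : Continuous (fun τ : ℝ => n * K / (1 - n / p) * τ ^ (1 - n / p : ℝ)) :=
    continuous_const.mul (Real.continuous_rpow_const hα.le)
  have hac : Continuous (fun τ => avg μ τ f x) :=
    continuous_iff_continuousAt.2 fun τ => (hder τ).continuousAt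
  have h0 : avg μ 0 f x = f x := by simp [avg]
  -- In place of integrating, the primitive plus s times the average is shown to be monotone. This
  -- needs derivatives in the open interval only, as the bound is singular at 0; s = 1 and s = -1
  -- give the two sides.
  have key : ∀ s : ℝ, |s| = 1 → s * avg μ 0 f x - s * avg μ t f x
      ≤ n * K / (1 - n / p) * t ^ (1 - n / p : ℝ) := by
    intro s hs
    have hm : MonotoneOn (fun τ => n * K / (1 - n / p) * τ ^ (1 - n / p : ℝ) + s * avg μ τ f x)
        (Icc 0 t) := by
      have hd : ∀ τ ∈ Ioo 0 t, HasDerivAt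
          (fun τ => n * K / (1 - n / p) * τ ^ (1 - n / p : ℝ) + s * avg μ τ f x)
          (n * K * τ ^ (-(n / p : ℝ)) + s * ∫ z, fderiv ℝ f (x - τ • z) (-z) ∂μ) τ :=
        fun τ hτ => (hB τ hτ).add ((hder τ).const_mul s)
      refine monotoneOn_of_deriv_nonneg (convex_Icc 0 t)
        (hBc.add (continuous_const.mul hac)).continuousOn ?_ ?_
      · rw [interior_Icc]
        exact fun τ hτ => (hd τ hτ).differentiableAt.differentiableWithinAt
      · rw [interior_Icc]
        intro τ hτ
        rw [(hd τ hτ).deriv]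
        have h1 := hbd τ hτ
        have h2 : |s * ∫ z, fderiv ℝ f (x - τ • z) (-z) ∂μ| ≤ n * K * τ ^ (-(n / p : ℝ)) := by
          rwa [abs_mul, hs, one_mul]
        linarith [(abs_le.1 h2).1]
    have := hm (left_mem_Icc.2 ht.le) (right_mem_Icc.2 ht.le) ht.le
    simp only [Real.zero_rpow hα.ne', mul_zero, zero_add] at this
    linarith
  rw [← h0, abs_le]
  constructor
  · have := key (-1) (by simp)
    linarith
  · have := key 1 (by simp)
    linarith

/-- Bounded partial derivatives give Lipschitz bounds. -/
lemma abs_sub_le_of_partialDeriv_le {f : Eucl n → ℝ} (hf : Differentiable ℝ f) {x y : Eucl n}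
    {t : ℝ} (ht : 0 < t) (hy : y ∈ openCube x t) {K : ℝ}
    (h : ∀ z ∈ openCube x t, ∑ i, |partialDeriv i f z| ≤ K) : |f x - f y| ≤ t * K := by
  have hx := mem_openCube_self x ht
  obtain ⟨z, hz, hzf⟩ := domain_mvt (f := f) (f' := fderiv ℝ f) (s := openCube x t)
    (fun z _ => (hf z).hasFDerivAt.hasFDerivWithinAt) (convex_openCube x t) hy hx
  rw [hzf]
  refine (abs_fderiv_le f z (x - y) (s := t) fun i => ?_).trans
    (mul_le_mul_of_nonneg_left (h z ((convex_openCube x t).segment_subset hy hx hz)) ht.le)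
  have := (hy i).le
  rwa [abs_sub_comm] at this

end Average

/-! ### Sup and Hölder bounds from Lᵖ bounds -/

section Hoelder

variable {n : ℕ} {μ : Measure (Eucl n)} [IsProbabilityMeasure μ]

lemma differentiable_avg {f : Eucl n → ℝ} (hf : ContDiff ℝ ∞ f) (hfc : HasCompactSupport f)
    (t : ℝ) : Differentiable ℝ (avg μ t f) :=
  fun x => (hasFDerivAt_avg hf hfc t x).differentiableAt

/-- The value f x is its deviation from the average plus the average. Applied at a fixed scale, this
is the Sobolev embedding into bounded functions. -/
lemma abs_le_of_eLpNorm_le (hμ : μ ≤ volume)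
    (hc : ∀ᵐ z ∂μ, z ∈ openCube (0 : Eucl n) 1) {p : ℝ} (hp : 1 ≤ p) (hnp : (n : ℝ) < p)
    {t : ℝ} (ht : 0 < t) {x : Eucl n} {U : Set (Eucl n)}
    (hU : MeasurableSet U) (hx : openCube x t ⊆ U) {f : Eucl n → ℝ} (hf : ContDiff ℝ ∞ f)
    (hfc : HasCompactSupport f) {K : ℝ} (hK : 0 ≤ K)
    (h0 : eLpNorm f (ENNReal.ofReal p) (volume.restrict U) ≤ ENNReal.ofReal K)
    (h : ∀ i, eLpNorm (partialDeriv i f) (ENNReal.ofReal p) (volume.restrict U)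
      ≤ ENNReal.ofReal K) :
    |f x| ≤ n * K / (1 - n / p) * t ^ (1 - n / p : ℝ) + t ^ (-(n / p : ℝ)) * K := by
  have h1 := abs_sub_avg_le_of_eLpNorm_partialDeriv_le hμ hc hp hnp ht hU hx hf hfc hK h
  have h2 := avg_abs_le_of_eLpNorm_le hμ hc hp ht hU hx hf.continuous hK h0
  have h3 := abs_avg_le (μ := μ) (f := f) t x
  have h4 := abs_add_le (f x - avg μ t f x) (avg μ t f x)
  rw [sub_add_cancel] at h4
  linarith

/-- Pass from f x to f y through the averages at both points: the outer steps are Morrey estimates,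
and the middle one holds because the average has gradient O(t^(-n/p)). -/
lemma abs_sub_le_of_eLpNorm_partialDeriv_le (hμ : μ ≤ volume)
    (hc : ∀ᵐ z ∂μ, z ∈ openCube (0 : Eucl n) 1) {p : ℝ} (hp : 1 ≤ p) (hnp : (n : ℝ) < p)
    {t : ℝ} (ht : 0 < t) {x : Eucl n} {U : Set (Eucl n)}
    (hU : MeasurableSet U) (hx : ∀ y ∈ openCube x t, openCube y t ⊆ U) {f : Eucl n → ℝ}
    (hf : ContDiff ℝ ∞ f) (hfc : HasCompactSupport f) {K : ℝ} (hK : 0 ≤ K)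
    (h : ∀ i, eLpNorm (partialDeriv i f) (ENNReal.ofReal p) (volume.restrict U)
      ≤ ENNReal.ofReal K) {y : Eucl n} (hy : y ∈ openCube x t) :
    |f x - f y| ≤ 3 * (n * K / (1 - n / p) * t ^ (1 - n / p : ℝ)) := by
  have hp0 : (0 : ℝ) < p := by linarith
  have hnp0 : (0 : ℝ) ≤ n / p := by positivity
  have hα : 0 < 1 - n / p := by
    rw [sub_pos, div_lt_one hp0]; exact hnp
  have hM := fun z (hz : openCube z t ⊆ U) =>
    abs_sub_avg_le_of_eLpNorm_partialDeriv_le hμ hc hp hnp ht hU hz hf hfc hK h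
  have h1 := hM x (hx x (mem_openCube_self x ht))
  have h2 := hM y (hx y hy)
  have h3 : |avg μ t f x - avg μ t f y| ≤ t * (n * (t ^ (-(n / p : ℝ)) * K)) := by
    refine abs_sub_le_of_partialDeriv_le (differentiable_avg hf hfc t) ht hy fun z hz => ?_
    calc ∑ i, |partialDeriv i (avg μ t f) z| ≤ ∑ _i : Fin n, t ^ (-(n / p : ℝ)) * K := by
          refine Finset.sum_le_sum fun i _ => ?_
          rw [partialDeriv_avg hf hfc]
          exact (abs_avg_le t z).trans (avg_abs_le_of_eLpNorm_le hμ hc hp ht hU (hx z hz)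
            (contDiff_partialDeriv hf i).continuous hK (h i))
      _ = n * (t ^ (-(n / p : ℝ)) * K) := by simp
  -- Since 1 - n/p ≤ 1, dividing by it only increases the bound, so the middle step fits the same
  -- constant as the outer ones.
  have h4 : t * (n * (t ^ (-(n / p : ℝ)) * K)) ≤ n * K / (1 - n / p) * t ^ (1 - n / p : ℝ) := by
    have h5 : t ^ (1 - n / p : ℝ) = t * t ^ (-(n / p : ℝ)) := by
      rw [sub_eq_add_neg, Real.rpow_add ht, Real.rpow_one]
    have h6 : (n * K : ℝ) ≤ n * K / (1 - n / p) := le_div_self (by positivity) hα (by linarith)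
    calc t * (n * (t ^ (-(n / p : ℝ)) * K)) = n * K * t ^ (1 - n / p : ℝ) := by rw [h5]; ring
      _ ≤ _ := mul_le_mul_of_nonneg_right h6 (by positivity)
  rw [abs_le] at *
  constructor <;> linarith [h1.1, h1.2, h2.1, h2.2, h3.1, h3.2]

lemma abs_avg_sub_le_of_eLpNorm_partialDeriv_le (hμ : μ ≤ volume)
    (hc : ∀ᵐ z ∂μ, z ∈ openCube (0 : Eucl n) 1) {p : ℝ} (hp : 1 ≤ p) (hnp : (n : ℝ) < p)
    {t : ℝ} (ht : 0 < t) {x : Eucl n} {U : Set (Eucl n)}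
    (hU : MeasurableSet U) (hx : ∀ y ∈ openCube x t, openCube y t ⊆ U) {f : Eucl n → ℝ}
    (hf : ContDiff ℝ ∞ f) (hfc : HasCompactSupport f) {K : ℝ} (hK : 0 ≤ K)
    (h : ∀ i, eLpNorm (partialDeriv i f) (ENNReal.ofReal p) (volume.restrict U)
      ≤ ENNReal.ofReal K) {y : Eucl n} (hy : y ∈ openCube x t) :
    |avg μ t f x - f y| ≤ 4 * (n * K / (1 - n / p) * t ^ (1 - n / p : ℝ)) := by
  have h1 := abs_sub_avg_le_of_eLpNorm_partialDeriv_le hμ hc hp hnp ht hU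
    (hx x (mem_openCube_self x ht)) hf hfc hK h
  have h2 := abs_sub_le_of_eLpNorm_partialDeriv_le hμ hc hp hnp ht hU hx hf hfc hK h hy
  rw [abs_le] at *
  constructor <;> linarith [h1.1, h1.2, h2.1, h2.2]

end Hoelder

/-! ### Pairs of a number and a nearby bounded function -/

/-- The number `a` and the function `A` are bounded by `K` on `S` and differ by at most `K ε`. -/
structure Near {n : ℕ} (S : Set (Eucl n)) (K ε a : ℝ) (A : Eucl n → ℝ) : Prop where
  abs_left : |a| ≤ K
  abs_right : ∀ y ∈ S, |A y| ≤ K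
  abs_sub : ∀ y ∈ S, |a - A y| ≤ K * ε

namespace Near

variable {n : ℕ} {S : Set (Eucl n)} {K K' ε a b : ℝ} {A B : Eucl n → ℝ}

lemma nonneg (h : Near S K ε a A) : 0 ≤ K := (abs_nonneg _).trans h.abs_left

lemma mono (h : Near S K ε a A) (hε : 0 ≤ ε) (hK : K ≤ K') : Near S K' ε a A :=
  ⟨h.abs_left.trans hK, fun y hy => (h.abs_right y hy).trans hK,
    fun y hy => (h.abs_sub y hy).trans (mul_le_mul_of_nonneg_right hK hε)⟩

lemma add (h : Near S K ε a A) (h' : Near S K' ε b B) :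
    Near S (K + K') ε (a + b) (fun y => A y + B y) := by
  refine ⟨(abs_add_le _ _).trans (add_le_add h.abs_left h'.abs_left),
    fun y hy => (abs_add_le _ _).trans (add_le_add (h.abs_right y hy) (h'.abs_right y hy)),
    fun y hy => ?_⟩
  rw [add_sub_add_comm, add_mul]
  exact (abs_add_le _ _).trans (add_le_add (h.abs_sub y hy) (h'.abs_sub y hy))

lemma neg (h : Near S K ε a A) : Near S K ε (-a) (fun y => -A y) := by
  refine ⟨by rw [abs_neg]; exact h.abs_left, fun y hy => by rw [abs_neg]; exact h.abs_right y hy,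
    fun y hy => ?_⟩
  rw [neg_sub_neg, abs_sub_comm]
  exact h.abs_sub y hy

lemma sub (h : Near S K ε a A) (h' : Near S K' ε b B) :
    Near S (K + K') ε (a - b) (fun y => A y - B y) := by
  simpa only [sub_eq_add_neg] using h.add h'.neg

/-- The factor 2 counts the two terms of ab - AB = a(b - B) + (a - A)B. -/
lemma mul (h : Near S K ε a A) (h' : Near S K' ε b B) :
    Near S (2 * K * K') ε (a * b) (fun y => A y * B y) := by
  have h0 := mul_nonneg h.nonneg h'.nonneg
  refine ⟨?_, fun y hy => ?_, fun y hy => ?_⟩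
  · rw [abs_mul]
    nlinarith [mul_le_mul h.abs_left h'.abs_left (abs_nonneg _) h.nonneg]
  · rw [abs_mul]
    nlinarith [mul_le_mul (h.abs_right y hy) (h'.abs_right y hy) (abs_nonneg _) h.nonneg]
  · have h1 : a * b - A y * B y = a * (b - B y) + (a - A y) * B y := by ring
    have h2 := mul_le_mul h.abs_left (h'.abs_sub y hy) (abs_nonneg _) h.nonneg
    have h3 := mul_le_mul (h.abs_sub y hy) (h'.abs_right y hy) (abs_nonneg _)
      ((abs_nonneg _).trans (h.abs_sub y hy))
    rw [h1]
    refine (abs_add_le _ _).trans ?_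
    rw [abs_mul, abs_mul]
    linarith

lemma const_mul (c : ℝ) (h : Near S K ε a A) : Near S (|c| * K) ε (c * a) (fun y => c * A y) := by
  refine ⟨?_, fun y hy => ?_, fun y hy => ?_⟩
  · rw [abs_mul]; exact mul_le_mul_of_nonneg_left h.abs_left (abs_nonneg _)
  · rw [abs_mul]; exact mul_le_mul_of_nonneg_left (h.abs_right y hy) (abs_nonneg _)
  · rw [← mul_sub, abs_mul, mul_assoc]
    exact mul_le_mul_of_nonneg_left (h.abs_sub y hy) (abs_nonneg _)

lemma sum {N : ℕ} {a : Fin N → ℝ} {A : Fin N → Eucl n → ℝ}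
    (h : ∀ i, Near S K ε (a i) (A i)) :
    Near S (N * K) ε (∑ i, a i) (fun y => ∑ i, A i y) := by
  refine ⟨?_, fun y hy => ?_, fun y hy => ?_⟩
  · refine (Finset.abs_sum_le_sum_abs _ _).trans
      ((Finset.sum_le_sum fun i _ => (h i).abs_left).trans (by simp))
  · refine (Finset.abs_sum_le_sum_abs _ _).trans
      ((Finset.sum_le_sum fun i _ => (h i).abs_right y hy).trans (by simp))
  · rw [← Finset.sum_sub_distrib]
    refine (Finset.abs_sum_le_sum_abs _ _).trans
      ((Finset.sum_le_sum fun i _ => (h i).abs_sub y hy).trans (by simp [mul_assoc]))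

end Near

/-- The average of `f` at `x` is defined and differs from `c` by at most `C`. -/
structure AvgNear {n : ℕ} (μ : Measure (Eucl n)) (t : ℝ) (x : Eucl n) (C c : ℝ)
    (f : Eucl n → ℝ) : Prop where
  integrable : Integrable (fun z => f (x - t • z)) μ
  abs_sub : |c - avg μ t f x| ≤ C

namespace AvgNear

variable {n : ℕ} {μ : Measure (Eucl n)} {t C C' c c' : ℝ} {x : Eucl n} {f f' : Eucl n → ℝ}

lemma add (h : AvgNear μ t x C c f) (h' : AvgNear μ t x C' c' f') :
    AvgNear μ t x (C + C') (c + c') (fun y => f y + f' y) := by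
  refine ⟨h.integrable.add h'.integrable, ?_⟩
  have : avg μ t (fun y => f y + f' y) x = avg μ t f x + avg μ t f' x :=
    integral_add h.integrable h'.integrable
  rw [this, add_sub_add_comm]
  exact (abs_add_le _ _).trans (add_le_add h.abs_sub h'.abs_sub)

lemma const_mul (a : ℝ) (h : AvgNear μ t x C c f) :
    AvgNear μ t x (|a| * C) (a * c) (fun y => a * f y) := by
  refine ⟨h.integrable.const_mul a, ?_⟩
  have : avg μ t (fun y => a * f y) x = a * avg μ t f x := integral_const_mul _ _
  rw [this, ← mul_sub, abs_mul]
  exact mul_le_mul_of_nonneg_left h.abs_sub (abs_nonneg _)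

lemma sub (h : AvgNear μ t x C c f) (h' : AvgNear μ t x C' c' f') :
    AvgNear μ t x (C + C') (c - c') (fun y => f y - f' y) := by
  simpa [sub_eq_add_neg] using h.add (h'.const_mul (-1))

lemma sum {N : ℕ} {c : Fin N → ℝ} {f : Fin N → Eucl n → ℝ}
    (h : ∀ i, AvgNear μ t x C (c i) (f i)) :
    AvgNear μ t x (N * C) (∑ i, c i) (fun y => ∑ i, f i y) := by
  refine ⟨integrable_finsetSum _ fun i _ => (h i).integrable, ?_⟩
  have : avg μ t (fun y => ∑ i, f i y) x = ∑ i, avg μ t (f i) x :=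
    integral_finsetSum _ fun i _ => (h i).integrable
  rw [this, ← Finset.sum_sub_distrib]
  exact (Finset.abs_sum_le_sum_abs _ _).trans
    ((Finset.sum_le_sum fun i _ => (h i).abs_sub).trans (by simp))

lemma mono (h : AvgNear μ t x C c f) (hC : C ≤ C') : AvgNear μ t x C' c f :=
  ⟨h.integrable, h.abs_sub.trans hC⟩

end AvgNear

lemma aestronglyMeasurable_comp_of_continuousOn {n : ℕ} {μ : Measure (Eucl n)}
    (hc : ∀ᵐ z ∂μ, z ∈ openCube (0 : Eucl n) 1)
    {t : ℝ} (ht : 0 < t) {x : Eucl n} {f : Eucl n → ℝ} (hf : ContinuousOn f (openCube x t)) :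
    AEStronglyMeasurable (fun z => f (x - t • z)) μ := by
  rw [← Measure.restrict_eq_self_of_ae_mem hc]
  refine ContinuousOn.aestronglyMeasurable ?_ (isOpen_openCube _ _).measurableSet
  exact hf.comp (by fun_prop) fun z hz => sub_smul_mem_openCube ht hz

section NearAverage

variable {n : ℕ} {μ : Measure (Eucl n)} [IsProbabilityMeasure μ]

lemma integrable_comp_of_continuousOn (hc : ∀ᵐ z ∂μ, z ∈ openCube (0 : Eucl n) 1)
    {t : ℝ} (ht : 0 < t) {x : Eucl n} {f : Eucl n → ℝ} (hf : ContinuousOn f (openCube x t))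
    {K : ℝ} (hK : ∀ y ∈ openCube x t, |f y| ≤ K) : Integrable (fun z => f (x - t • z)) μ := by
  refine Integrable.of_bound (aestronglyMeasurable_comp_of_continuousOn hc ht hf) K ?_
  filter_upwards [hc] with z hz
  exact hK _ (sub_smul_mem_openCube ht hz)

/-- `AvgNear` is stable under linear operations only. Products of bounded factors are therefore
formed in `Near` and averaged afterwards. -/
lemma Near.avgNear (hc : ∀ᵐ z ∂μ, z ∈ openCube (0 : Eucl n) 1) {t : ℝ} (ht : 0 < t)
    {x : Eucl n} {K ε a : ℝ} {A : Eucl n → ℝ} (h : Near (openCube x t) K ε a A)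
    (hA : ContinuousOn A (openCube x t)) : AvgNear μ t x (K * ε) a A := by
  have hi := integrable_comp_of_continuousOn hc ht hA h.abs_right
  exact ⟨hi, abs_sub_avg_le hc ht hi h.abs_sub⟩

/-- The commutator a·avg f - avg (A f) is the average of (a - A) f, so f needs an averaged bound but
no pointwise one. This is what handles the second derivatives of the metric. -/
lemma Near.avgNear_mul (hc : ∀ᵐ z ∂μ, z ∈ openCube (0 : Eucl n) 1) {t : ℝ} (ht : 0 < t)
    {x : Eucl n} {K ε a : ℝ} {A : Eucl n → ℝ} (h : Near (openCube x t) K ε a A)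
    (hA : ContinuousOn A (openCube x t)) {f : Eucl n → ℝ} (hf : Continuous f)
    (hfc : HasCompactSupport f) {L : ℝ} (hL : avg μ t (fun y => |f y|) x ≤ L) (hε : 0 ≤ ε) :
    AvgNear μ t x (K * ε * L) (a * avg μ t f x) (fun y => A y * f y) := by
  have hfi := integrable_comp_sub_smul (μ := μ) hf hfc t x
  have hi : Integrable (fun z => A (x - t • z) * f (x - t • z)) μ := by
    refine hfi.bdd_mul (c := K) (aestronglyMeasurable_comp_of_continuousOn hc ht hA) ?_
    filter_upwards [hc] with z hz
    exact h.abs_right _ (sub_smul_mem_openCube ht hz)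
  refine ⟨hi, ?_⟩
  have h1 : a * avg μ t f x - avg μ t (fun y => A y * f y) x
      = ∫ z, (a - A (x - t • z)) * f (x - t • z) ∂μ := by
    have : ∀ z, (a - A (x - t • z)) * f (x - t • z)
        = a * f (x - t • z) - A (x - t • z) * f (x - t • z) := fun z => by ring
    simp_rw [this]
    rw [integral_sub (hfi.const_mul a) hi, integral_const_mul]
    rfl
  have h2 : |∫ z, (a - A (x - t • z)) * f (x - t • z) ∂μ|
      ≤ ∫ z, K * ε * |f (x - t • z)| ∂μ := by
    refine norm_integral_le_of_norm_le (μ := μ)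
      (f := fun z => (a - A (x - t • z)) * f (x - t • z)) (hfi.abs.const_mul _) ?_
    filter_upwards [hc] with z hz
    rw [Real.norm_eq_abs, abs_mul]
    exact mul_le_mul_of_nonneg_right (h.abs_sub _ (sub_smul_mem_openCube ht hz)) (abs_nonneg _)
  rw [h1]
  refine h2.trans ?_
  rw [integral_const_mul]
  exact mul_le_mul_of_nonneg_left hL (mul_nonneg h.nonneg hε)

end NearAverage

/-! ### Inverse matrices -/

section Inverse

variable {n : ℕ}

lemma isUnit_det_of_lower_bound {A : Matrix (Fin n) (Fin n) ℝ} {c : ℝ} (hc : 0 < c)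
    (h : ∀ v : Eucl n, c * ‖v‖ ^ 2 ≤ ∑ k, ∑ l, A k l * v k * v l) : IsUnit A.det := by
  rw [isUnit_iff_ne_zero]
  intro h0
  obtain ⟨v, hv, hv0⟩ := Matrix.exists_mulVec_eq_zero_iff.2 h0
  have h1 := h (WithLp.toLp 2 v)
  have h2 : ∑ k, ∑ l, A k l * v k * v l = ∑ k, v k * (A.mulVec v) k := by
    refine Finset.sum_congr rfl fun k _ => ?_
    rw [Matrix.mulVec, dotProduct, Finset.mul_sum]
    exact Finset.sum_congr rfl fun l _ => by ring
  simp only [h2, hv0] at h1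
  have h3 : (WithLp.toLp 2 v : Eucl n) ≠ 0 := by
    simpa using hv
  have h4 : 0 < c * ‖(WithLp.toLp 2 v : Eucl n)‖ ^ 2 :=
    mul_pos hc (pow_pos (norm_pos_iff.2 h3) 2)
  simp at h1
  linarith

/-- Test the form on the m-th column w of A⁻¹: its value there is w m ≤ ‖w‖, hence c‖w‖ ≤ 1.
Symmetry plays no role. -/
lemma abs_inv_le_of_lower_bound {A : Matrix (Fin n) (Fin n) ℝ} {c : ℝ} (hc : 0 < c)
    (h : ∀ v : Eucl n, c * ‖v‖ ^ 2 ≤ ∑ k, ∑ l, A k l * v k * v l) (i m : Fin n) :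
    |A⁻¹ i m| ≤ 1 / c := by
  have hu := isUnit_det_of_lower_bound hc h
  set w : Eucl n := WithLp.toLp 2 (fun i => A⁻¹ i m) with hw
  have h1 : ∑ k, ∑ l, A k l * w k * w l = w m := by
    have : ∀ k, ∑ l, A k l * w k * w l = w k * (1 : Matrix (Fin n) (Fin n) ℝ) k m := by
      intro k
      rw [← Matrix.mul_nonsing_inv A hu, Matrix.mul_apply, Finset.mul_sum]
      exact Finset.sum_congr rfl fun l _ => by simp only [hw]; ring
    simp [this, Matrix.one_apply]
  have h2 := h w
  rw [h1] at h2
  have h3 : ∀ j, |w j| ≤ ‖w‖ := fun j => PiLp.norm_apply_le w j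
  have h4 : ‖w‖ ≤ 1 / c := by
    rw [le_div_iff₀ hc]
    rcases (norm_nonneg w).eq_or_lt with h0 | h0
    · rw [← h0]; simp
    · have := (le_abs_self _).trans (h3 m)
      nlinarith
  exact (h3 i).trans h4

/-- Resolvent identity A⁻¹ - B⁻¹ = -A⁻¹(A - B)B⁻¹, estimated entrywise. -/
lemma abs_inv_sub_inv_le {A B : Matrix (Fin n) (Fin n) ℝ} {K δ : ℝ} (hA : IsUnit A.det)
    (hB : IsUnit B.det) (hAK : ∀ i m, |A⁻¹ i m| ≤ K) (hBK : ∀ i m, |B⁻¹ i m| ≤ K)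
    (hδ : ∀ i m, |A i m - B i m| ≤ δ) (i m : Fin n) :
    |A⁻¹ i m - B⁻¹ i m| ≤ n * (n * (K * δ * K)) := by
  have hK : 0 ≤ K := (abs_nonneg _).trans (hAK i m)
  have hδ0 : 0 ≤ δ := (abs_nonneg _).trans (hδ i m)
  have h1 : A⁻¹ - B⁻¹ = -(A⁻¹ * (A - B) * B⁻¹) := by
    rw [Matrix.mul_sub, Matrix.sub_mul, Matrix.nonsing_inv_mul A hA, Matrix.mul_assoc A⁻¹ B,
      Matrix.mul_nonsing_inv B hB]
    simp
  rw [← Matrix.sub_apply, h1, Matrix.neg_apply, abs_neg, Matrix.mul_apply]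
  calc |∑ b, (A⁻¹ * (A - B)) i b * B⁻¹ b m| ≤ ∑ _b : Fin n, n * (K * δ * K) := by
        refine (Finset.abs_sum_le_sum_abs _ _).trans (Finset.sum_le_sum fun b _ => ?_)
        rw [abs_mul, ← mul_assoc]
        refine mul_le_mul ?_ (hBK b m) (abs_nonneg _) (by positivity)
        rw [Matrix.mul_apply]
        refine (Finset.abs_sum_le_sum_abs _ _).trans
          ((Finset.sum_le_sum (g := fun _ => K * δ) fun a _ => ?_).trans (by simp))
        rw [abs_mul]
        exact mul_le_mul (hAK i a) (hδ a b) (abs_nonneg _) hK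
    _ = n * (n * (K * δ * K)) := by simp

lemma differentiableAt_det {G : Eucl n → Matrix (Fin n) (Fin n) ℝ} {x : Eucl n}
    (hG : ∀ a b, DifferentiableAt ℝ (fun y => G y a b) x) :
    DifferentiableAt ℝ (fun y => (G y).det) x := by
  simp only [Matrix.det_apply']
  refine DifferentiableAt.fun_sum fun σ _ => ?_
  exact (HasFDerivAt.finsetProd fun i _ => (hG (σ i) i).hasFDerivAt).differentiableAt.const_mul _

/-- Cramer's rule reduces this to determinants. -/
lemma differentiableAt_inv_apply {G : Eucl n → Matrix (Fin n) (Fin n) ℝ} {x : Eucl n}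
    (hG : ∀ a b, DifferentiableAt ℝ (fun y => G y a b) x) (hx : IsUnit (G x).det) (i m : Fin n) :
    DifferentiableAt ℝ (fun y => (G y)⁻¹ i m) x := by
  simp only [Matrix.inv_def, Matrix.smul_apply, Ring.inverse_eq_inv', smul_eq_mul,
    Matrix.adjugate_apply]
  refine ((differentiableAt_det hG).inv hx.ne_zero).mul (differentiableAt_det fun a b => ?_)
  by_cases h : a = m
  · subst h; simp
  · simpa [Matrix.updateRow_ne h] using hG a b

/-- Differentiate G⁻¹G = 1, valid near x since invertibility is an open condition, and multiply by
G⁻¹ on the right. -/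
lemma partialDeriv_inv_apply {G : Eucl n → Matrix (Fin n) (Fin n) ℝ} {x : Eucl n}
    (hG : ∀ a b, DifferentiableAt ℝ (fun y => G y a b) x) (hx : IsUnit (G x).det) (l i m : Fin n) :
    partialDeriv l (fun y => (G y)⁻¹ i m) x
      = -∑ a, ∑ b, (G x)⁻¹ i a * partialDeriv l (fun y => G y a b) x * (G x)⁻¹ b m := by
  have hu : ∀ᶠ y in 𝓝 x, IsUnit (G y).det :=
    ((differentiableAt_det hG).continuousAt.eventually_ne hx.ne_zero).mono
      fun y hy => isUnit_iff_ne_zero.2 hy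
  set dJ : Matrix (Fin n) (Fin n) ℝ :=
    Matrix.of fun i m => partialDeriv l (fun y => (G y)⁻¹ i m) x with hdJ
  set dG : Matrix (Fin n) (Fin n) ℝ :=
    Matrix.of fun a b => partialDeriv l (fun y => G y a b) x with hdG
  have h1 : dJ * G x + (G x)⁻¹ * dG = 0 := by
    ext a b
    have h2 : (fun y => ∑ k, (G y)⁻¹ a k * G y k b)
        =ᶠ[𝓝 x] fun _ => (1 : Matrix (Fin n) (Fin n) ℝ) a b := by
      filter_upwards [hu] with y hy
      rw [← Matrix.mul_apply, Matrix.nonsing_inv_mul _ hy]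
    have h3 : HasFDerivAt (fun y => ∑ k, (G y)⁻¹ a k * G y k b) _ x :=
      HasFDerivAt.fun_sum fun k _ =>
        (differentiableAt_inv_apply hG hx a k).hasFDerivAt.mul (hG k b).hasFDerivAt
    have h4 := h2.fderiv_eq (𝕜 := ℝ)
    rw [h3.fderiv] at h4
    have h5 := congrArg (fun L : Eucl n →L[ℝ] ℝ => L (stdVec l)) h4
    simp only [fderiv_fun_const, Pi.zero_apply, zero_apply,
      sum_apply, add_apply,
      smul_apply, smul_eq_mul] at h5
    rw [Matrix.add_apply, Matrix.mul_apply, Matrix.mul_apply, ← Finset.sum_add_distrib,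
      Matrix.zero_apply, ← h5]
    refine Finset.sum_congr rfl fun k _ => ?_
    simp only [hdJ, hdG, Matrix.of_apply, partialDeriv]
    ring
  have h6 : dJ = -((G x)⁻¹ * dG * (G x)⁻¹) := by
    have h7 := congrArg (fun A => A * (G x)⁻¹) h1
    simp only [Matrix.add_mul, Matrix.zero_mul, Matrix.mul_assoc dJ,
      Matrix.mul_nonsing_inv _ hx, Matrix.mul_one] at h7
    exact eq_neg_of_add_eq_zero_left h7
  have h8 := congrFun (congrFun h6 i) m
  rw [Matrix.neg_apply, Matrix.mul_apply] at h8
  simp only [hdJ, Matrix.of_apply] at h8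
  rw [h8, Finset.sum_comm]
  simp only [Matrix.mul_apply, Finset.sum_mul, hdG, Matrix.of_apply]

/-! ### The derivatives of the Christoffel symbols -/

/-- Twice the Christoffel symbol of the first kind. -/
noncomputable def christoffelLower (G : Eucl n → Matrix (Fin n) (Fin n) ℝ) (m k l : Fin n)
    (x : Eucl n) : ℝ :=
  partialDeriv l (fun y => G y m k) x + partialDeriv k (fun y => G y m l) x
    - partialDeriv m (fun y => G y k l) x

/-- The derivative of the inverse metric, expressed by the derivative of the metric. -/
noncomputable def invDeriv (G : Eucl n → Matrix (Fin n) (Fin n) ℝ) (l i m : Fin n)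
    (x : Eucl n) : ℝ :=
  ∑ a, ∑ b, (G x)⁻¹ i a * partialDeriv l (fun y => G y a b) x * (G x)⁻¹ b m

/-- The derivative of a Christoffel symbol, expressed by the inverse metric and the derivatives of
the metric. -/
noncomputable def christoffelDeriv (G : Eucl n → Matrix (Fin n) (Fin n) ℝ) (μ i k l : Fin n)
    (x : Eucl n) : ℝ :=
  (1 / 2 : ℝ) * ∑ m, ((G x)⁻¹ i m * partialDeriv μ (partialDeriv l fun y => G y m k) x
    + (G x)⁻¹ i m * partialDeriv μ (partialDeriv k fun y => G y m l) x
    - (G x)⁻¹ i m * partialDeriv μ (partialDeriv m fun y => G y k l) x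
    - invDeriv G μ i m x * christoffelLower G m k l x)

lemma partialDeriv_christoffel {G : Eucl n → Matrix (Fin n) (Fin n) ℝ} {x : Eucl n}
    (hG : ∀ a b, DifferentiableAt ℝ (fun y => G y a b) x)
    (hG' : ∀ i a b, DifferentiableAt ℝ (partialDeriv i fun y => G y a b) x)
    (hx : IsUnit (G x).det) (μ i k l : Fin n) :
    partialDeriv μ (christoffel G i k l) x = christoffelDeriv G μ i k l x := by
  have h1 : HasFDerivAt (christoffel G i k l) _ x :=
    (HasFDerivAt.fun_sum fun m (_ : m ∈ Finset.univ) =>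
      (differentiableAt_inv_apply hG hx i m).hasFDerivAt.mul
        (((hG' l m k).hasFDerivAt.add (hG' k m l).hasFDerivAt).sub
          (hG' m k l).hasFDerivAt)).const_mul (1 / 2 : ℝ)
  rw [partialDeriv, h1.fderiv, christoffelDeriv]
  simp only [smul_apply, sum_apply,
    add_apply, sub_apply, smul_eq_mul]
  congr 1
  refine Finset.sum_congr rfl fun m _ => ?_
  have h2 := partialDeriv_inv_apply hG hx μ i m
  change _ = - invDeriv G μ i m x at h2
  rw [← neg_eq_iff_eq_neg] at h2
  rw [← h2]
  simp only [partialDeriv, christoffelLower, Pi.add_apply, Pi.sub_apply]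
  ring

end Inverse

/-! ### Averages of metrics -/

/-- The componentwise average of a tensor field. -/
noncomputable def avgMetric {n : ℕ} (μ : Measure (Eucl n)) (t : ℝ)
    (F : Eucl n → Matrix (Fin n) (Fin n) ℝ) (x : Eucl n) : Matrix (Fin n) (Fin n) ℝ :=
  Matrix.of fun a b => avg μ t (fun y => F y a b) x

/-- A smooth tensor field with compact support that is uniformly positive on the open set `U`, with
`Lᵖ` bounds of its derivatives on `U`. -/
structure MetricBounds {n : ℕ} (p K c : ℝ) (U : Set (Eucl n))
    (F : Eucl n → Matrix (Fin n) (Fin n) ℝ) : Prop where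
  isOpen : IsOpen U
  contDiff : ∀ a b, ContDiff ℝ ∞ fun y => F y a b
  hasCompactSupport : ∀ a b, HasCompactSupport fun y => F y a b
  lower : ∀ x ∈ U, ∀ v : Eucl n, c * ‖v‖ ^ 2 ≤ ∑ k, ∑ l, F x k l * v k * v l
  eLpNorm_le : ∀ i a b, eLpNorm (partialDeriv i fun y => F y a b) (ENNReal.ofReal p)
    (volume.restrict U) ≤ ENNReal.ofReal K
  eLpNorm_le' : ∀ i j a b, eLpNorm (partialDeriv i (partialDeriv j fun y => F y a b))
    (ENNReal.ofReal p) (volume.restrict U) ≤ ENNReal.ofReal K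

lemma Near.of_le {n : ℕ} {S : Set (Eucl n)} {K ε ε' a : ℝ} {A : Eucl n → ℝ}
    (h : Near S K ε a A) (hε : ε ≤ ε') : Near S K ε' a A :=
  ⟨h.abs_left, h.abs_right,
    fun y hy => (h.abs_sub y hy).trans (mul_le_mul_of_nonneg_left hε h.nonneg)⟩

lemma AvgNear.mul_const {n : ℕ} {μ : Measure (Eucl n)} {t C c : ℝ} {x : Eucl n}
    {f : Eucl n → ℝ} (h : AvgNear μ t x C c f) (a : ℝ) :
    AvgNear μ t x (C * |a|) (c * a) (fun y => f y * a) := by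
  simpa only [mul_comm] using h.const_mul a

lemma AvgNear.congr {n : ℕ} {μ : Measure (Eucl n)} (hc : ∀ᵐ z ∂μ, z ∈ openCube (0 : Eucl n) 1)
    {t C c c' : ℝ} (ht : 0 < t) {x : Eucl n} {f f' : Eucl n → ℝ} (h : AvgNear μ t x C c f)
    (hcc : c = c') (hff : ∀ y ∈ openCube x t, f y = f' y) : AvgNear μ t x C c' f' := by
  have h1 : (fun z => f (x - t • z)) =ᵐ[μ] fun z => f' (x - t • z) := by
    filter_upwards [hc] with z hz
    exact hff _ (sub_smul_mem_openCube ht hz)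
  refine ⟨h.integrable.congr h1, ?_⟩
  have h2 : avg μ t f' x = avg μ t f x := (integral_congr_ae h1).symm
  rw [h2, ← hcc]
  exact h.abs_sub

/-- The constant in the estimate for the derivatives of the Christoffel symbols. -/
noncomputable def christoffelDerivConst (n : ℕ) (K L : ℝ) : ℝ :=
  |1 / 2| * (n * (K * L + K * L + K * L
    + 2 * (n * (n * (2 * (2 * K * K) * K))) * (K + K + K)))

/-- The constant in the estimate for the components of the curvature tensor. -/
noncomputable def riemCompConst (n : ℕ) (K L : ℝ) : ℝ :=
  christoffelDerivConst n K L + christoffelDerivConst n K L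
    + n * (2 * (|1 / 2| * (n * (2 * K * (K + K + K)))) * (|1 / 2| * (n * (2 * K * (K + K + K))))
      + 2 * (|1 / 2| * (n * (2 * K * (K + K + K)))) * (|1 / 2| * (n * (2 * K * (K + K + K)))))

lemma riemCompConst_nonneg (n : ℕ) {K L : ℝ} (hK : 0 ≤ K) (hL : 0 ≤ L) :
    0 ≤ riemCompConst n K L := by
  unfold riemCompConst christoffelDerivConst; positivity

namespace MetricBounds

variable {n : ℕ} {p K₀ c : ℝ} {U : Set (Eucl n)} {F : Eucl n → Matrix (Fin n) (Fin n) ℝ}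

lemma differentiableAt (hF : MetricBounds p K₀ c U F) (x : Eucl n) (a b : Fin n) :
    DifferentiableAt ℝ (fun y => F y a b) x :=
  (hF.contDiff a b).differentiable (by simp) x

lemma differentiableAt_partialDeriv (hF : MetricBounds p K₀ c U F) (x : Eucl n) (i a b : Fin n) :
    DifferentiableAt ℝ (partialDeriv i fun y => F y a b) x :=
  (contDiff_partialDeriv (hF.contDiff a b) i).differentiable (by simp) x

lemma continuous_partialDeriv (hF : MetricBounds p K₀ c U F) (i a b : Fin n) :
    Continuous (partialDeriv i fun y => F y a b) :=
  (contDiff_partialDeriv (hF.contDiff a b) i).continuous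

lemma continuousOn_inv (hF : MetricBounds p K₀ c U F) (hc0 : 0 < c) (i m : Fin n) :
    ContinuousOn (fun y => (F y)⁻¹ i m) U := fun y hy =>
  (differentiableAt_inv_apply (fun a b => hF.differentiableAt y a b)
    (isUnit_det_of_lower_bound hc0 (hF.lower y hy)) i m).continuousAt.continuousWithinAt

lemma continuous_christoffelLower (hF : MetricBounds p K₀ c U F) (m k l : Fin n) :
    Continuous (christoffelLower F m k l) :=
  ((hF.continuous_partialDeriv l m k).add (hF.continuous_partialDeriv k m l)).sub
    (hF.continuous_partialDeriv m k l)

lemma continuousOn_christoffel (hF : MetricBounds p K₀ c U F) (hc0 : 0 < c) (i k l : Fin n) :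
    ContinuousOn (christoffel F i k l) U :=
  continuousOn_const.mul (continuousOn_finsetSum _ fun m _ =>
    (hF.continuousOn_inv hc0 i m).mul (hF.continuous_christoffelLower m k l).continuousOn)

lemma continuousOn_invDeriv (hF : MetricBounds p K₀ c U F) (hc0 : 0 < c) (l i m : Fin n) :
    ContinuousOn (invDeriv F l i m) U :=
  continuousOn_finsetSum _ fun a _ => continuousOn_finsetSum _ fun b _ =>
    ((hF.continuousOn_inv hc0 i a).mul (hF.continuous_partialDeriv l a b).continuousOn).mul
      (hF.continuousOn_inv hc0 b m)

lemma continuousOn_christoffelDeriv (hF : MetricBounds p K₀ c U F) (hc0 : 0 < c)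
    (μ i k l : Fin n) : ContinuousOn (christoffelDeriv F μ i k l) U := by
  have h2 : ∀ i j a b, ContinuousOn (partialDeriv i (partialDeriv j fun y => F y a b)) U :=
    fun i j a b => (contDiff_partialDeriv (contDiff_partialDeriv (hF.contDiff a b) j)
      i).continuous.continuousOn
  exact continuousOn_const.mul (continuousOn_finsetSum _ fun m _ =>
    ((((hF.continuousOn_inv hc0 i m).mul (h2 _ _ _ _)).add
      ((hF.continuousOn_inv hc0 i m).mul (h2 _ _ _ _))).sub
      ((hF.continuousOn_inv hc0 i m).mul (h2 _ _ _ _))).sub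
      ((hF.continuousOn_invDeriv hc0 μ i m).mul
        (hF.continuous_christoffelLower m k l).continuousOn))

lemma riemComp_eq (hF : MetricBounds p K₀ c U F) (hc0 : 0 < c) {x : Eucl n} (hx : x ∈ U)
    (ρ σ μ ν : Fin n) :
    riemComp F ρ σ μ ν x = christoffelDeriv F μ ρ ν σ x - christoffelDeriv F ν ρ μ σ x
      + ∑ κ, (christoffel F ρ μ κ x * christoffel F κ ν σ x
        - christoffel F ρ ν κ x * christoffel F κ μ σ x) := by
  have hd := hF.differentiableAt x
  have hd' := hF.differentiableAt_partialDeriv x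
  have hu := isUnit_det_of_lower_bound hc0 (hF.lower x hx)
  rw [riemComp, partialDeriv_christoffel hd hd' hu, partialDeriv_christoffel hd hd' hu]

lemma continuousOn_riem (hF : MetricBounds p K₀ c U F) (hc0 : 0 < c) (w : Fin 4 → Fin n → ℝ) :
    ContinuousOn (fun y => riem F y w) U := by
  refine continuousOn_finsetSum _ fun ρ _ => continuousOn_finsetSum _ fun σ _ =>
    continuousOn_finsetSum _ fun μ _ => continuousOn_finsetSum _ fun ν _ =>
    ContinuousOn.mul (ContinuousOn.mul (ContinuousOn.mul (ContinuousOn.mul ?_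
      continuousOn_const) continuousOn_const) continuousOn_const) continuousOn_const
  refine ContinuousOn.congr ?_ fun y hy => hF.riemComp_eq hc0 hy ρ σ μ ν
  have hΓ := hF.continuousOn_christoffel hc0
  exact ((hF.continuousOn_christoffelDeriv hc0 _ _ _ _).sub
    (hF.continuousOn_christoffelDeriv hc0 _ _ _ _)).add (continuousOn_finsetSum _ fun κ _ =>
      ((hΓ _ _ _).mul (hΓ _ _ _)).sub ((hΓ _ _ _).mul (hΓ _ _ _)))

section Near

variable {μ : Measure (Eucl n)} {t K ε : ℝ} {x : Eucl n}

lemma near_christoffelLower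
    (hD : ∀ i a b, Near (openCube x t) K ε (partialDeriv i (fun y => avgMetric μ t F y a b) x)
      (partialDeriv i fun y => F y a b)) (m k l : Fin n) :
    Near (openCube x t) (K + K + K) ε (christoffelLower (avgMetric μ t F) m k l x)
      (christoffelLower F m k l) :=
  ((hD l m k).add (hD k m l)).sub (hD m k l)

lemma near_christoffel
    (hJ : ∀ i m, Near (openCube x t) K ε ((avgMetric μ t F x)⁻¹ i m) (fun y => (F y)⁻¹ i m))
    (hD : ∀ i a b, Near (openCube x t) K ε (partialDeriv i (fun y => avgMetric μ t F y a b) x)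
      (partialDeriv i fun y => F y a b)) (i k l : Fin n) :
    Near (openCube x t) (|1 / 2| * (n * (2 * K * (K + K + K)))) ε
      (christoffel (avgMetric μ t F) i k l x) (christoffel F i k l) :=
  (Near.sum fun m => (hJ i m).mul (near_christoffelLower hD m k l)).const_mul _

lemma near_invDeriv
    (hJ : ∀ i m, Near (openCube x t) K ε ((avgMetric μ t F x)⁻¹ i m) (fun y => (F y)⁻¹ i m))
    (hD : ∀ i a b, Near (openCube x t) K ε (partialDeriv i (fun y => avgMetric μ t F y a b) x)
      (partialDeriv i fun y => F y a b)) (l i m : Fin n) :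
    Near (openCube x t) (n * (n * (2 * (2 * K * K) * K))) ε
      (invDeriv (avgMetric μ t F) l i m x) (invDeriv F l i m) :=
  Near.sum fun a => Near.sum fun b => ((hJ i a).mul (hD l a b)).mul (hJ b m)

end Near

variable {μ : Measure (Eucl n)} [IsProbabilityMeasure μ]

/-- For fixed v the quadratic form is linear in the metric, so a common lower bound survives
averaging. -/
lemma lower_avgMetric (hF : MetricBounds p K₀ c U F)
    (hc : ∀ᵐ z ∂μ, z ∈ openCube (0 : Eucl n) 1) {t : ℝ} (ht : 0 < t) {x : Eucl n}
    (hx : openCube x t ⊆ U) (v : Eucl n) :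
    c * ‖v‖ ^ 2 ≤ ∑ k, ∑ l, avgMetric μ t F x k l * v k * v l := by
  have hi : ∀ k l, Integrable (fun z => F (x - t • z) k l * v k * v l) μ := fun k l =>
    ((integrable_comp_sub_smul (hF.contDiff k l).continuous (hF.hasCompactSupport k l)
      t x).mul_const _).mul_const _
  have h1 : ∑ k, ∑ l, avgMetric μ t F x k l * v k * v l
      = ∫ z, ∑ k, ∑ l, F (x - t • z) k l * v k * v l ∂μ := by
    rw [integral_finsetSum _ fun k _ => integrable_finsetSum _ fun l _ => hi k l]
    refine Finset.sum_congr rfl fun k _ => ?_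
    rw [integral_finsetSum _ fun l _ => hi k l]
    refine Finset.sum_congr rfl fun l _ => ?_
    rw [integral_mul_const, integral_mul_const]
    rfl
  have h2 : ∫ _z, c * ‖v‖ ^ 2 ∂μ ≤ ∫ z, ∑ k, ∑ l, F (x - t • z) k l * v k * v l ∂μ := by
    refine integral_mono_ae (integrable_const _)
      (integrable_finsetSum _ fun k _ => integrable_finsetSum _ fun l _ => hi k l) ?_
    filter_upwards [hc] with z hz
    exact hF.lower _ (hx (sub_smul_mem_openCube ht hz)) v
  rw [h1]
  simpa using h2

lemma partialDeriv_avgMetric (hF : MetricBounds p K₀ c U F) (t : ℝ) (i a b : Fin n) :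
    partialDeriv i (fun y => avgMetric μ t F y a b)
      = avg μ t (partialDeriv i fun y => F y a b) :=
  partialDeriv_avg (hF.contDiff a b) (hF.hasCompactSupport a b) t i

lemma partialDeriv_partialDeriv_avgMetric (hF : MetricBounds p K₀ c U F) (t : ℝ)
    (i j a b : Fin n) :
    partialDeriv i (partialDeriv j (fun y => avgMetric μ t F y a b))
      = avg μ t (partialDeriv i (partialDeriv j fun y => F y a b)) := by
  rw [hF.partialDeriv_avgMetric, partialDeriv_avg (contDiff_partialDeriv (hF.contDiff a b) j)
    (hasCompactSupport_partialDeriv (hF.hasCompactSupport a b) j)]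

section Curvature

variable {t K ε L : ℝ} {x : Eucl n}

/-- Two rates are needed for the inverse metric. Against second derivatives the Lipschitz rate t is
used, and t · (L/t)ε = Lε absorbs their growth; in the products of first derivatives the weaker rate
ε suffices. -/
lemma avgNear_christoffelDeriv (hF : MetricBounds p K₀ c U F) (hc0 : 0 < c)
    (hc : ∀ᵐ z ∂μ, z ∈ openCube (0 : Eucl n) 1) (ht : 0 < t) (hx : openCube x t ⊆ U)
    (hJt : ∀ i m, Near (openCube x t) K t ((avgMetric μ t F x)⁻¹ i m) (fun y => (F y)⁻¹ i m))
    (hJ : ∀ i m, Near (openCube x t) K ε ((avgMetric μ t F x)⁻¹ i m) (fun y => (F y)⁻¹ i m))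
    (hD : ∀ i a b, Near (openCube x t) K ε (partialDeriv i (fun y => avgMetric μ t F y a b) x)
      (partialDeriv i fun y => F y a b))
    (hH : ∀ i j a b, avg μ t (fun y => |partialDeriv i (partialDeriv j fun y => F y a b) y|) x
      ≤ L / t * ε) (η i k l : Fin n) :
    AvgNear μ t x (christoffelDerivConst n K L * ε)
      (christoffelDeriv (avgMetric μ t F) η i k l x) (christoffelDeriv F η i k l) := by
  have h1 : ∀ i m j j' a b, AvgNear μ t x (K * L * ε)
      ((avgMetric μ t F x)⁻¹ i m * partialDeriv j (partialDeriv j'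
        (fun y => avgMetric μ t F y a b)) x)
      (fun y => (F y)⁻¹ i m * partialDeriv j (partialDeriv j' fun y => F y a b) y) := by
    intro i m j j' a b
    rw [hF.partialDeriv_partialDeriv_avgMetric]
    have := (hJt i m).avgNear_mul hc ht ((hF.continuousOn_inv hc0 i m).mono hx)
      (contDiff_partialDeriv (contDiff_partialDeriv (hF.contDiff a b) j') j).continuous
      (hasCompactSupport_partialDeriv
        (hasCompactSupport_partialDeriv (hF.hasCompactSupport a b) j') j) (hH j j' a b) ht.le
    refine this.mono (le_of_eq ?_)
    field_simp
  have h2 : ∀ m, AvgNear μ t x ((2 * (n * (n * (2 * (2 * K * K) * K))) * (K + K + K)) * ε)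
      (invDeriv (avgMetric μ t F) η i m x * christoffelLower (avgMetric μ t F) m k l x)
      (fun y => invDeriv F η i m y * christoffelLower F m k l y) := fun m =>
    ((near_invDeriv hJ hD η i m).mul (near_christoffelLower hD m k l)).avgNear hc ht
      (((hF.continuousOn_invDeriv hc0 η i m).mono hx).mul
        (hF.continuous_christoffelLower m k l).continuousOn)
  refine ((AvgNear.sum fun m => (((h1 i m η l m k).add (h1 i m η k m l)).sub
    (h1 i m η m k l)).sub (h2 m)).const_mul (1 / 2 : ℝ)).mono (le_of_eq ?_)
  rw [christoffelDerivConst]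
  ring

lemma avgNear_riemComp (hF : MetricBounds p K₀ c U F) (hc0 : 0 < c)
    (hc : ∀ᵐ z ∂μ, z ∈ openCube (0 : Eucl n) 1) (ht : 0 < t) (hx : openCube x t ⊆ U)
    (hJt : ∀ i m, Near (openCube x t) K t ((avgMetric μ t F x)⁻¹ i m) (fun y => (F y)⁻¹ i m))
    (hJ : ∀ i m, Near (openCube x t) K ε ((avgMetric μ t F x)⁻¹ i m) (fun y => (F y)⁻¹ i m))
    (hD : ∀ i a b, Near (openCube x t) K ε (partialDeriv i (fun y => avgMetric μ t F y a b) x)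
      (partialDeriv i fun y => F y a b))
    (hH : ∀ i j a b, avg μ t (fun y => |partialDeriv i (partialDeriv j fun y => F y a b) y|) x
      ≤ L / t * ε) (ρ σ η ν : Fin n) :
    AvgNear μ t x (riemCompConst n K L * ε)
      (riemComp (avgMetric μ t F) ρ σ η ν x) (riemComp F ρ σ η ν) := by
  have h1 := hF.avgNear_christoffelDeriv hc0 hc ht hx hJt hJ hD hH
  have hΓ := near_christoffel hJ hD
  have hΓc : ∀ i k l, ContinuousOn (christoffel F i k l) (openCube x t) := fun i k l =>
    (hF.continuousOn_christoffel hc0 i k l).mono hx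
  have h2 := fun κ => ((((hΓ ρ η κ).mul (hΓ κ ν σ)).sub ((hΓ ρ ν κ).mul (hΓ κ η σ))).avgNear hc ht
    (((hΓc _ _ _).mul (hΓc _ _ _)).sub ((hΓc _ _ _).mul (hΓc _ _ _))))
  have h3 := (((h1 η ρ ν σ).sub (h1 ν ρ η σ)).add (AvgNear.sum h2)).mono
    (C' := riemCompConst n K L * ε) (le_of_eq (by rw [riemCompConst]; ring))
  refine h3.congr hc ht ?_ fun y hy => (hF.riemComp_eq hc0 (hx hy) ρ σ η ν).symm
  have hd : ∀ a b, DifferentiableAt ℝ (fun y => avgMetric μ t F y a b) x := fun a b =>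
    differentiable_avg (hF.contDiff a b) (hF.hasCompactSupport a b) t x
  have hd' : ∀ i a b, DifferentiableAt ℝ (partialDeriv i fun y => avgMetric μ t F y a b) x := by
    intro i a b
    rw [hF.partialDeriv_avgMetric]
    exact differentiable_avg (contDiff_partialDeriv (hF.contDiff a b) i)
      (hasCompactSupport_partialDeriv (hF.hasCompactSupport a b) i) t x
  have hu := isUnit_det_of_lower_bound hc0 (hF.lower_avgMetric hc ht hx)
  rw [riemComp, partialDeriv_christoffel hd hd' hu, partialDeriv_christoffel hd hd' hu]

end Curvature

end MetricBounds

/-! ### The averaged curvature estimate with uniform constants -/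

lemma avgNear_riem {n : ℕ} {μ : Measure (Eucl n)} {t C V : ℝ} {x : Eucl n}
    {G G' : Eucl n → Matrix (Fin n) (Fin n) ℝ}
    (h : ∀ ρ σ η ν, AvgNear μ t x C (riemComp G' ρ σ η ν x) (riemComp G ρ σ η ν)) (hC : 0 ≤ C)
    {w : Fin 4 → Fin n → ℝ} (hw : ∀ i j, |w i j| ≤ V) :
    AvgNear μ t x (n ^ 4 * C * V ^ 4) (riem G' x w) (fun y => riem G y w) := by
  have h1 : ∀ ρ σ η ν, AvgNear μ t x (C * V ^ 4)
      (riemComp G' ρ σ η ν x * w 0 η * w 1 ν * w 2 σ * w 3 ρ)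
      (fun y => riemComp G ρ σ η ν y * w 0 η * w 1 ν * w 2 σ * w 3 ρ) := by
    intro ρ σ η ν
    have hV : 0 ≤ V := (abs_nonneg _).trans (hw 0 η)
    refine ((((((h ρ σ η ν).mul_const _).mul_const _).mul_const _).mul_const _)).mono ?_
    calc C * |w 0 η| * |w 1 ν| * |w 2 σ| * |w 3 ρ| ≤ C * V * V * V * V := by
          gcongr <;> apply hw
      _ = C * V ^ 4 := by ring
  refine (AvgNear.sum fun ρ => AvgNear.sum fun σ => AvgNear.sum fun η => AvgNear.sum fun ν =>
    h1 ρ σ η ν).mono (le_of_eq (by ring))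

/-- The constant is built from n, p, K₀, c and T alone, before the measure and the metric are
introduced. The double cube condition leaves room for averages of scale T centred at any point of
the cube around x. -/
theorem MetricBounds.exists_avgNear_riem (n : ℕ) {p K₀ c T : ℝ} (hp : 1 ≤ p) (hnp : (n : ℝ) < p)
    (hK₀ : 0 ≤ K₀) (hc0 : 0 < c) (hT : 0 < T) (hT1 : T ≤ 1) :
    ∃ C : ℝ, 0 ≤ C ∧ ∀ (μ : Measure (Eucl n)) [IsProbabilityMeasure μ], μ ≤ volume →
      (∀ᵐ z ∂μ, z ∈ openCube (0 : Eucl n) 1) →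
      ∀ (U : Set (Eucl n)) (F : Eucl n → Matrix (Fin n) (Fin n) ℝ), MetricBounds p K₀ c U F →
      ∀ x : Eucl n, (∀ y ∈ openCube x T, openCube y T ⊆ U) → ∀ t : ℝ, 0 < t → t ≤ T →
      ∀ (w : Fin 4 → Fin n → ℝ) (V : ℝ), (∀ i j, |w i j| ≤ V) →
        AvgNear μ t x (C * V ^ 4 * t ^ (1 - n / p : ℝ)) (riem (avgMetric μ t F) x w)
          (fun y => riem F y w) := by
  have hp0 : (0 : ℝ) < p := by linarith
  have hα : 0 < 1 - n / p := by
    rw [sub_pos, div_lt_one hp0]; exact hnp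
  have hnp0 : (0 : ℝ) ≤ n / p := by positivity
  set A : ℝ := n * K₀ / (1 - n / p) with hA
  have hA0 : 0 ≤ A := by positivity
  -- M serves both as sup bound of the first derivatives (Morrey error plus average at scale T) and,
  -- through 4A, as their Hölder constant.
  set M : ℝ := 4 * A + T ^ (-(n / p : ℝ)) * K₀ with hM
  have hM0 : 0 ≤ M := by positivity
  -- The first summand bounds the entries of the inverses; the second is their Lipschitz constant,
  -- from the resolvent identity with δ = 2nMt.
  set N : ℝ := 1 / c + n * (n * (1 / c * (2 * (n * M)) * (1 / c))) with hN
  have hN0 : 0 ≤ N := by positivity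
  have hNc : 1 / c ≤ N := by
    rw [hN]; linarith [show 0 ≤ n * (n * (1 / c * (2 * (n * M)) * (1 / c))) by positivity]
  refine ⟨n ^ 4 * riemCompConst n (M + N) K₀,
    mul_nonneg (by positivity) (riemCompConst_nonneg n (add_nonneg hM0 hN0) hK₀), ?_⟩
  intro μ _ hμ hc U F hF x hxT t ht htT w V hw
  have hx : ∀ y ∈ openCube x t, openCube y t ⊆ U := fun y hy =>
    (openCube_mono y htT).trans (hxT y (openCube_mono x htT hy))
  have hxU : openCube x t ⊆ U := hx x (mem_openCube_self x ht)
  set ε : ℝ := t ^ (1 - n / p : ℝ) with hε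
  have hε0 : 0 ≤ ε := by positivity
  have htε : t ≤ ε := by
    conv_lhs => rw [← Real.rpow_one t]
    exact Real.rpow_le_rpow_of_exponent_ge ht (htT.trans hT1) (by linarith)
  have hTα : T ^ (1 - n / p : ℝ) ≤ 1 := Real.rpow_le_one hT.le hT1 hα.le
  have hUm := hF.isOpen.measurableSet
  have hd := fun i a b => contDiff_partialDeriv (hF.contDiff a b) i
  have hdc := fun i a b => hasCompactSupport_partialDeriv (hF.hasCompactSupport a b) i
  -- The embedding is applied at the fixed scale T: at scale t its term t^(-n/p) would blow up.
  have hsup : ∀ y ∈ openCube x T, ∀ i a b, |partialDeriv i (fun y => F y a b) y| ≤ M := by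
    intro y hy i a b
    refine (abs_le_of_eLpNorm_le hμ hc hp hnp hT hUm (hxT y hy) (hd i a b) (hdc i a b) hK₀
      (hF.eLpNorm_le i a b) (fun j => hF.eLpNorm_le' j i a b)).trans ?_
    rw [hM]
    have := mul_le_mul_of_nonneg_left hTα hA0
    linarith
  have hsupt := fun y (hy : y ∈ openCube x t) => hsup y (openCube_mono x htT hy)
  have hD : ∀ i a b, Near (openCube x t) M ε (partialDeriv i (fun y => avgMetric μ t F y a b) x)
      (partialDeriv i fun y => F y a b) := by
    intro i a b
    rw [hF.partialDeriv_avgMetric]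
    refine ⟨?_, fun y hy => hsupt y hy i a b, fun y hy => ?_⟩
    · have := abs_sub_avg_le hc ht
        (integrable_comp_sub_smul (μ := μ) (hd i a b).continuous (hdc i a b) t x) (a := 0) (b := M)
        (fun y hy => by simpa using hsupt y hy i a b)
      simpa using this
    · refine (abs_avg_sub_le_of_eLpNorm_partialDeriv_le hμ hc hp hnp ht hUm hx (hd i a b)
        (hdc i a b) hK₀ (fun j => hF.eLpNorm_le' j i a b) hy).trans ?_
      rw [← mul_assoc]
      refine mul_le_mul_of_nonneg_right ?_ hε0
      rw [hM]
      linarith [show 0 ≤ T ^ (-(n / p : ℝ)) * K₀ by positivity]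
  have hLip : ∀ y ∈ openCube x t, ∀ a b, |F x a b - F y a b| ≤ t * (n * M) := by
    intro y hy a b
    refine abs_sub_le_of_partialDeriv_le ((hF.contDiff a b).differentiable (by simp)) ht hy
      fun z hz => ?_
    exact (Finset.sum_le_sum fun i _ => hsupt z hz i a b).trans (by simp)
  have hH : ∀ y ∈ openCube x t, ∀ a b, |avgMetric μ t F x a b - F y a b| ≤ 2 * (n * M) * t := by
    intro y hy a b
    have h1 := abs_sub_avg_le hc ht (integrable_comp_sub_smul (μ := μ)
      (hF.contDiff a b).continuous (hF.hasCompactSupport a b) t x) (fun y hy => hLip y hy a b)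
    have h2 := hLip y hy a b
    change |F x a b - avgMetric μ t F x a b| ≤ _ at h1
    rw [abs_le] at *
    constructor <;> linarith [h1.1, h1.2, h2.1, h2.2]
  have hlow := hF.lower_avgMetric hc ht hxU
  have hJt : ∀ i m, Near (openCube x t) N t ((avgMetric μ t F x)⁻¹ i m)
      (fun y => (F y)⁻¹ i m) := by
    intro i m
    refine ⟨(abs_inv_le_of_lower_bound hc0 hlow i m).trans hNc, fun y hy =>
      (abs_inv_le_of_lower_bound hc0 (hF.lower y (hxU hy)) i m).trans hNc, fun y hy => ?_⟩
    refine (abs_inv_sub_inv_le (isUnit_det_of_lower_bound hc0 hlow)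
      (isUnit_det_of_lower_bound hc0 (hF.lower y (hxU hy))) (abs_inv_le_of_lower_bound hc0 hlow)
      (abs_inv_le_of_lower_bound hc0 (hF.lower y (hxU hy))) (hH y hy) i m).trans ?_
    rw [hN, add_mul]
    have h1 : 0 ≤ 1 / c * t := by positivity
    have h2 : n * (n * (1 / c * (2 * (n * M) * t) * (1 / c)))
        = n * (n * (1 / c * (2 * (n * M)) * (1 / c))) * t := by ring
    rw [h2]
    linarith
  have hJt' := fun i m => (hJt i m).mono ht.le (show N ≤ M + N by linarith)
  have h1 := fun ρ σ η ν => hF.avgNear_riemComp (L := K₀) hc0 hc ht hxU hJt'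
    (fun i m => (hJt' i m).of_le htε)
    (fun i a b => (hD i a b).mono hε0 (show M ≤ M + N by linarith)) (fun i j a b => by
      refine (avg_abs_le_of_eLpNorm_le hμ hc hp ht hUm hxU (contDiff_partialDeriv (hd j a b)
        i).continuous hK₀ (hF.eLpNorm_le' i j a b)).trans (le_of_eq ?_)
      rw [hε, sub_eq_add_neg, Real.rpow_add ht, Real.rpow_one]
      field_simp) ρ σ η ν
  refine (avgNear_riem h1 (mul_nonneg (riemCompConst_nonneg n (add_nonneg hM0 hN0) hK₀) hε0)
    hw).mono (le_of_eq (by ring))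

/-! ### Smoothness of the coordinate metric -/

section Manifold

variable {n : ℕ} {M : Type*} [TopologicalSpace M] [ChartedSpace (Eucl n) M]
  [IsManifold 𝓘(ℝ, Eucl n) ∞ M]

/-- The pushed-forward field is the tangent map of ψ composed with the constant section x ↦ (x, v).
-/
lemma contMDiffOn_mfderiv_const {ψ : Eucl n → M} {s : Set (Eucl n)} (hs : IsOpen s)
    (hψ : ContMDiffOn 𝓘(ℝ, Eucl n) 𝓘(ℝ, Eucl n) ∞ ψ s) (v : Eucl n) :
    ContMDiffOn 𝓘(ℝ, Eucl n) 𝓘(ℝ, Eucl n).tangent ∞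
      (fun x => (⟨ψ x, mfderiv 𝓘(ℝ, Eucl n) 𝓘(ℝ, Eucl n) ψ x v⟩ :
        TangentBundle 𝓘(ℝ, Eucl n) M)) s := by
  have h1 := hψ.contMDiffOn_tangentMapWithin (m := ∞) (by simp) hs.uniqueMDiffOn
  have h2 : ContMDiff 𝓘(ℝ, Eucl n) 𝓘(ℝ, Eucl n).tangent ∞
      (fun x => (⟨x, v⟩ : TangentBundle 𝓘(ℝ, Eucl n) (Eucl n))) :=
    contMDiff_vectorSpace_iff_contDiff.2 contDiff_const
  refine (h1.comp h2.contMDiffOn (s := s) fun x hx => hx).congr fun x hx => ?_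
  simp only [Function.comp_apply, tangentMapWithin]
  rw [mfderivWithin_of_isOpen hs hx]

lemma contDiffOn_pullbackMetric (g : SmoothMetric n M) {r : ℝ} {x₀ : M}
    {ψ : OpenPartialHomeomorph (Eucl n) M} (hψ : IsPointedChart r x₀ ψ) (i j : Fin n) :
    ContDiffOn ℝ ∞ (fun x => pullbackMetric g ψ x i j) (ball (0 : Eucl n) r) := by
  have h1 : ContMDiffOn 𝓘(ℝ, Eucl n) 𝓘(ℝ, Eucl n) ∞ ψ (ball (0 : Eucl n) r) := by
    have := contMDiffOn_symm_of_mem_maximalAtlas hψ.mem_atlas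
    simpa [hψ.source_eq] using this
  have h2 := contMDiffOn_mfderiv_const isOpen_ball h1
  rw [← contMDiffOn_iff_contDiffOn]
  intro x hx
  have h3 : ContMDiffWithinAt 𝓘(ℝ, Eucl n) 𝓘(ℝ, Eucl n) ∞ ψ (ball (0 : Eucl n) r) x := h1 x hx
  have h4 := (g.contMDiff (ψ x)).comp_contMDiffWithinAt x h3
  have h5 := ContMDiffWithinAt.clm_bundle_apply₂ (F₁ := Eucl n) (F₂ := Eucl n) (F₃ := ℝ)
    (E₃ := fun _ : M => ℝ) h4 (h2 (stdVec i) x hx) (h2 (stdVec j) x hx)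
  exact (Bundle.contMDiffWithinAt_totalSpace.1 h5).2

end Manifold

/-! ### Mollification as an average -/

/-- The measure with density `φ`. -/
noncomputable def kernelMeasure {n : ℕ} (φ : Eucl n → ℝ) : Measure (Eucl n) :=
  volume.withDensity fun z => ENNReal.ofReal (φ z)

namespace IsMollificationKernel

variable {n : ℕ} {φ : Eucl n → ℝ}

lemma hasCompactSupport (hφ : IsMollificationKernel φ) : HasCompactSupport φ := by
  refine HasCompactSupport.intro (isCompact_closedBall (0 : Eucl n) (n * 2)) fun z hz => ?_
  by_contra h
  refine hz (mem_closedBall.2 (dist_le_of_mem_openCube fun i => ?_))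
  have := hφ.support_subset (Function.mem_support.2 h) i
  simp only [PiLp.zero_apply, sub_zero]
  linarith

lemma integrable (hφ : IsMollificationKernel φ) : Integrable φ :=
  hφ.contDiff.continuous.integrable_of_hasCompactSupport hφ.hasCompactSupport

lemma isProbabilityMeasure (hφ : IsMollificationKernel φ) :
    IsProbabilityMeasure (kernelMeasure φ) := by
  constructor
  rw [kernelMeasure, withDensity_apply _ MeasurableSet.univ, Measure.restrict_univ,
    ← ofReal_integral_eq_lintegral_ofReal hφ.integrable (Eventually.of_forall hφ.nonneg),
    hφ.integral_eq_one, ENNReal.ofReal_one]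

lemma kernelMeasure_le (hφ : IsMollificationKernel φ) : kernelMeasure φ ≤ volume := by
  conv_rhs => rw [← withDensity_one (μ := (volume : Measure (Eucl n)))]
  exact withDensity_mono (Eventually.of_forall fun z => by simpa using hφ.le_one z)

lemma ae_mem_of_support_subset (hφ : IsMollificationKernel φ) {S : Set (Eucl n)}
    (hS : Function.support φ ⊆ S) : ∀ᵐ z ∂kernelMeasure φ, z ∈ S := by
  have := hφ.contDiff.continuous
  rw [kernelMeasure, ae_withDensity_iff (by fun_prop)]
  refine Eventually.of_forall fun z hz => hS fun h0 => hz ?_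
  rw [h0, ENNReal.ofReal_zero]

lemma isOpen_support (hφ : IsMollificationKernel φ) : IsOpen (Function.support φ) :=
  hφ.contDiff.continuous.isOpen_support

/-- The support of a continuous function is open. Coordinate projections are open maps, so each
image of the support lies in the interior of [-1, 1]. -/
lemma ae_mem_openCube (hφ : IsMollificationKernel φ) :
    ∀ᵐ z ∂kernelMeasure φ, z ∈ openCube (0 : Eucl n) 1 := by
  refine hφ.ae_mem_of_support_subset fun z hz i => ?_
  have h1 : IsOpenMap (EuclideanSpace.proj i : Eucl n →L[ℝ] ℝ) :=
    ContinuousLinearMap.isOpenMap _ fun a => ⟨EuclideanSpace.single i a, by simp⟩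
  have h2 : (EuclideanSpace.proj i : Eucl n →L[ℝ] ℝ) '' Function.support φ
      ⊆ interior (closedBall (0 : ℝ) 1) := by
    refine interior_maximal ?_ (h1 _ hφ.isOpen_support)
    rintro _ ⟨y, hy, rfl⟩
    simpa using hφ.support_subset hy i
  have h3 := h2 ⟨z, hz, rfl⟩
  rw [interior_closedBall _ one_ne_zero] at h3
  simpa using h3

lemma ae_mem_ball (hφ : IsMollificationKernel φ)
    (h : Function.support φ ⊆ closedBall (0 : Eucl n) 1) :
    ∀ᵐ z ∂kernelMeasure φ, z ∈ ball (0 : Eucl n) 1 := by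
  refine hφ.ae_mem_of_support_subset ?_
  rw [← interior_closedBall _ one_ne_zero]
  exact interior_maximal h hφ.isOpen_support

/-- The substitution y = tz cancels the factor t⁻ⁿ. -/
lemma mollify_eq_avg (hφ : IsMollificationKernel φ) {t : ℝ} (ht : 0 < t) (f : Eucl n → ℝ)
    (x : Eucl n) : mollify φ t f x = avg (kernelMeasure φ) t f x := by
  have hm : Measurable fun z => ENNReal.ofReal (φ z) := by
    have := hφ.contDiff.continuous
    fun_prop
  rw [avg, kernelMeasure, integral_withDensity_eq_integral_toReal_smul hm (by simp)]
  have h1 := Measure.integral_comp_smul (volume : Measure (Eucl n))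
    (fun y => φ (t⁻¹ • y) * f (x - y)) t
  simp only [inv_smul_smul₀ ht.ne', finrank_euclideanSpace, Fintype.card_fin] at h1
  have h2 : ∀ z, (ENNReal.ofReal (φ z)).toReal • f (x - t • z) = φ z * f (x - t • z) := fun z => by
    rw [ENNReal.toReal_ofReal (hφ.nonneg z), smul_eq_mul]
  simp_rw [h2]
  rw [h1, abs_of_pos (by positivity), smul_eq_mul, ← integral_const_mul]
  simp only [mollify, convolution, scaledKernel, ContinuousLinearMap.lsmul_apply, smul_eq_mul,
    mul_assoc]

lemma contDiff_avg (hφ : IsMollificationKernel φ) {t : ℝ} (ht : 0 < t) {f : Eucl n → ℝ}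
    (hf : ContDiff ℝ ∞ f) (hfc : HasCompactSupport f) :
    ContDiff ℝ ∞ (avg (kernelMeasure φ) t f) := by
  have h1 : avg (kernelMeasure φ) t f = mollify φ t f :=
    funext fun x => (hφ.mollify_eq_avg ht f x).symm
  rw [h1]
  refine hfc.contDiff_convolution_right _ ?_ hf
  have := hφ.contDiff.continuous
  exact Continuous.locallyIntegrable (by unfold scaledKernel; fun_prop)

/-- Only values on the cube around x are sampled, so extending G by zero or by a cutoff makes no
difference there. -/
lemma mollifyMetric_eq_avgMetric (hφ : IsMollificationKernel φ) {r t : ℝ} (ht : 0 < t)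
    {G F : Eucl n → Matrix (Fin n) (Fin n) ℝ} {U : Set (Eucl n)} (hU : U ⊆ ball 0 r)
    (hGF : ∀ y ∈ U, F y = G y) {x : Eucl n} (hx : openCube x t ⊆ U) :
    mollifyMetric φ r t G x = avgMetric (kernelMeasure φ) t F x := by
  ext a b
  simp only [mollifyMetric, avgMetric, Matrix.of_apply]
  rw [hφ.mollify_eq_avg ht]
  refine integral_congr_ae ?_
  filter_upwards [hφ.ae_mem_openCube] with z hz
  have h1 := hx (sub_smul_mem_openCube ht hz)
  rw [indicator_of_mem (hU h1), hGF _ h1]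

end IsMollificationKernel

/-! ### Localization -/

lemma partialDeriv_congr {n : ℕ} {f f' : Eucl n → ℝ} {x : Eucl n} (h : f =ᶠ[𝓝 x] f') (i : Fin n) :
    partialDeriv i f x = partialDeriv i f' x := by
  rw [partialDeriv, partialDeriv, h.fderiv_eq]

lemma christoffel_congr {n : ℕ} {G G' : Eucl n → Matrix (Fin n) (Fin n) ℝ} {x : Eucl n}
    (h : G =ᶠ[𝓝 x] G') (i k l : Fin n) : christoffel G i k l x = christoffel G' i k l x := by
  have h1 : ∀ a b, (fun y => G y a b) =ᶠ[𝓝 x] fun y => G' y a b := fun a b =>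
    h.mono fun y hy => by simp only [hy]
  simp only [christoffel, h.eq_of_nhds, partialDeriv_congr (h1 _ _)]

/-- Curvature depends only on the germ of the metric, which lets the cutoff metric and the original
one be exchanged. -/
lemma riem_congr {n : ℕ} {G G' : Eucl n → Matrix (Fin n) (Fin n) ℝ} {x : Eucl n}
    (h : G =ᶠ[𝓝 x] G') (w : Fin 4 → Fin n → ℝ) : riem G x w = riem G' x w := by
  have h1 : ∀ i k l, christoffel G i k l =ᶠ[𝓝 x] christoffel G' i k l := fun i k l =>
    h.eventuallyEq_nhds.mono fun y hy => christoffel_congr hy i k l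
  simp only [riem, riemComp, christoffel_congr h, partialDeriv_congr (h1 _ _ _)]

lemma partialDeriv_eq_iteratedFDeriv {n : ℕ} (f : Eucl n → ℝ) (x : Eucl n) (i : Fin n) :
    partialDeriv i f x = iteratedFDeriv ℝ 1 f x (fun m => stdVec (![i] m)) := by
  rw [iteratedFDeriv_one_apply]; rfl

lemma partialDeriv_partialDeriv_eq_iteratedFDeriv {n : ℕ} {f : Eucl n → ℝ} (hf : ContDiff ℝ ∞ f)
    (x : Eucl n) (i j : Fin n) :
    partialDeriv i (partialDeriv j f) x
      = iteratedFDeriv ℝ 2 f x (fun m => stdVec (![i, j] m)) := by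
  rw [iteratedFDeriv_two_apply]
  have h1 : DifferentiableAt ℝ (fderiv ℝ f) x :=
    (hf.fderiv_right (m := ∞) (by simp)).differentiable (by simp) x
  have h2 := h1.hasFDerivAt.clm_apply (hasFDerivAt_const (stdVec j : Eucl n) x)
  change fderiv ℝ (fun y => fderiv ℝ f y (stdVec j)) x (stdVec i) = _
  rw [h2.fderiv]
  simp

/-- A single component is dominated by the maximum norm of all of them, and the scaling factor
r^(k-n/p) is moved to the other side. -/
lemma SobolevChartNormLE.eLpNorm_le {n : ℕ} {p r Q : ℝ} (hr : 0 < r)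
    {G : Eucl n → Matrix (Fin n) (Fin n) ℝ} (hG : SobolevChartNormLE 2 p r Q G) {k : ℕ}
    (hk : k ≤ 2) {U : Set (Eucl n)} (hU : U ⊆ ball 0 r) (hUm : MeasurableSet U)
    {f : Eucl n → ℝ} {a b : Fin n} {I : Fin k → Fin n}
    (hf : ∀ x ∈ U, f x = nablaPow k G x a b I) :
    eLpNorm f (ENNReal.ofReal p) (volume.restrict U)
      ≤ ENNReal.ofReal (r ^ ((n : ℝ) / p - k) * Q) := by
  have h1 : eLpNorm f (ENNReal.ofReal p) (volume.restrict U)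
      ≤ eLpNorm (nablaPow k G) (ENNReal.ofReal p) (volume.restrict (ball 0 r)) := by
    refine (eLpNorm_mono_ae ?_).trans (eLpNorm_mono_measure _ (Measure.restrict_mono hU le_rfl))
    filter_upwards [ae_restrict_mem hUm] with x hx
    rw [hf x hx]
    exact (norm_le_pi_norm (nablaPow k G x a b) I).trans
      ((norm_le_pi_norm (nablaPow k G x a) b).trans (norm_le_pi_norm (nablaPow k G x) a))
  have h2 := mul_le_mul_right (hG.sobolev k hk) (ENNReal.ofReal (r ^ ((n : ℝ) / p - k)))
  rw [← mul_assoc, ← ENNReal.ofReal_mul (by positivity), ← Real.rpow_add hr,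
    show (n : ℝ) / p - k + (k - n / p) = 0 by ring, Real.rpow_zero, ENNReal.ofReal_one, one_mul,
    ← ENNReal.ofReal_mul (by positivity)] at h2
  exact h1.trans h2

/-- Multiply by a cutoff equal to 1 on the smaller ball. All bounds are required only there, so no
derivative of the cutoff enters the constants. -/
lemma exists_metricBounds {n : ℕ} {p r Q : ℝ} (hr : 0 < r) (hQ : 0 ≤ Q)
    {G : Eucl n → Matrix (Fin n) (Fin n) ℝ}
    (hGs : ∀ a b, ContDiffOn ℝ ∞ (fun x => G x a b) (ball (0 : Eucl n) r))
    (hG : SobolevChartNormLE 2 p r Q G) :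
    ∃ F : Eucl n → Matrix (Fin n) (Fin n) ℝ,
      MetricBounds p (r ^ ((n : ℝ) / p - 1) * Q + r ^ ((n : ℝ) / p - 2) * Q) (Real.exp (-2 * Q))
        (ball (0 : Eucl n) (7 * r / 8)) F ∧ ∀ y ∈ ball (0 : Eucl n) (7 * r / 8), F y = G y := by
  -- The outer radius stays below r, so that extending by zero across the sphere of radius r is
  -- smooth.
  let χ : ContDiffBump (0 : Eucl n) := ⟨7 * r / 8, 15 * r / 16, by linarith, by linarith⟩
  have hsub : ball (0 : Eucl n) (7 * r / 8) ⊆ ball 0 r := ball_subset_ball (by linarith)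
  set F : Eucl n → Matrix (Fin n) (Fin n) ℝ := fun y => χ y • G y with hF
  have hFG : ∀ y ∈ ball (0 : Eucl n) (7 * r / 8), F y = G y := fun y hy => by
    simp only [hF]
    rw [χ.one_of_mem_closedBall (ball_subset_closedBall hy), one_smul]
  have hFs : ∀ a b, ContDiff ℝ ∞ fun y => F y a b := by
    intro a b
    rw [contDiff_iff_contDiffAt]
    intro x
    by_cases hx : x ∈ ball (0 : Eucl n) r
    · exact (χ.contDiff.contDiffAt).mul ((hGs a b).contDiffAt (isOpen_ball.mem_nhds hx))
    · have h1 : (fun y => F y a b) =ᶠ[𝓝 x] fun _ => 0 := by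
        have h2 : {y : Eucl n | 15 * r / 16 < dist y 0} ∈ 𝓝 x := by
          refine (isOpen_lt continuous_const (by fun_prop)).mem_nhds ?_
          simp only [mem_ball, not_lt] at hx
          simp only [mem_ofPred_eq]
          linarith
        filter_upwards [h2] with y hy
        have : χ y = 0 := χ.zero_of_le_dist (le_of_lt hy)
        simp [hF, this]
      exact contDiffAt_const.congr_of_eventuallyEq h1
  have hloc : ∀ a b, ∀ x ∈ ball (0 : Eucl n) (7 * r / 8),
      (fun y => F y a b) =ᶠ[𝓝 x] fun y => G y a b := fun a b x hx => by
    filter_upwards [isOpen_ball.mem_nhds hx] with y hy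
    rw [hFG y hy]
  refine ⟨F, ⟨isOpen_ball, hFs, fun a b => ?_, fun x hx v => ?_, fun i a b => ?_,
    fun i j a b => ?_⟩, hFG⟩
  · exact χ.hasCompactSupport.mul_right
  · rw [hFG x hx]
    exact hG.lower x (hsub hx) v
  · refine (hG.eLpNorm_le hr (k := 1) (by norm_num) hsub measurableSet_ball (a := a) (b := b)
      (I := ![i]) fun x hx => ?_).trans (ENNReal.ofReal_le_ofReal ?_)
    · rw [partialDeriv_eq_iteratedFDeriv, nablaPow,
        ((hloc a b x hx).iteratedFDeriv ℝ 1).eq_of_nhds]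
    · have : 0 ≤ r ^ ((n : ℝ) / p - 2) * Q := by positivity
      simpa using this
  · refine (hG.eLpNorm_le hr (k := 2) le_rfl hsub measurableSet_ball (a := a) (b := b)
      (I := ![i, j]) fun x hx => ?_).trans (ENNReal.ofReal_le_ofReal ?_)
    · rw [partialDeriv_partialDeriv_eq_iteratedFDeriv (hFs a b), nablaPow,
        ((hloc a b x hx).iteratedFDeriv ℝ 2).eq_of_nhds]
    · have : 0 ≤ r ^ ((n : ℝ) / p - 1) * Q := by positivity
      simpa using this

/-- The essential bound says max ‖v‖ V = V almost everywhere; both sides are continuous on the open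
set U, so equality holds everywhere on it. -/
lemma norm_le_toReal_eLpNorm_top {X E : Type*} [TopologicalSpace X] [MeasurableSpace X]
    [NormedAddCommGroup E] {μ : Measure X} [μ.IsOpenPosMeasure]
    {U : Set X} (hU : IsOpen U) {v : X → E} (hv : ContinuousOn v U)
    (hv' : MemLp v ∞ (μ.restrict U)) {x : X} (hx : x ∈ U) :
    ‖v x‖ ≤ (eLpNorm v ∞ (μ.restrict U)).toReal := by
  set V := (eLpNorm v ∞ (μ.restrict U)).toReal with hV
  have h1 : (fun y => max ‖v y‖ V) =ᵐ[μ.restrict U] fun _ => V := by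
    filter_upwards [ae_le_eLpNormEssSup (f := v) (μ := μ.restrict U)] with y hy
    refine max_eq_right ?_
    rw [hV, ← ENNReal.ofReal_le_iff_le_toReal hv'.2.ne, ofReal_norm, eLpNorm_exponent_top]
    exact hy
  have h2 := Measure.eqOn_open_of_ae_eq h1 hU (hv.norm.sup continuousOn_const) continuousOn_const hx
  exact max_eq_right_iff.1 h2

/-! ### The curvature estimate -/

lemma pullbackMetric_symm {n : ℕ} {M : Type*} [TopologicalSpace M] [ChartedSpace (Eucl n) M]
    [IsManifold 𝓘(ℝ, Eucl n) ∞ M] (g : SmoothMetric n M) (ψ : Eucl n → M) (x : Eucl n)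
    (i j : Fin n) : pullbackMetric g ψ x i j = pullbackMetric g ψ x j i :=
  g.symm _ _ _

lemma posDef_of_lower_bound {n : ℕ} {A : Matrix (Fin n) (Fin n) ℝ} {c : ℝ} (hc : 0 < c)
    (hA : ∀ i j, A i j = A j i)
    (h : ∀ v : Eucl n, c * ‖v‖ ^ 2 ≤ ∑ k, ∑ l, A k l * v k * v l) : A.PosDef := by
  refine Matrix.PosDef.of_dotProduct_mulVec_pos ?_ fun v hv => ?_
  · ext i j
    simp [hA i j]
  · have h1 := h (WithLp.toLp 2 v)
    have h3 : (WithLp.toLp 2 v : Eucl n) ≠ 0 := by simpa using hv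
    have h4 : 0 < c * ‖(WithLp.toLp 2 v : Eucl n)‖ ^ 2 :=
      mul_pos hc (pow_pos (norm_pos_iff.2 h3) 2)
    refine h4.trans_le (h1.trans (le_of_eq ?_))
    rw [dotProduct]
    refine Finset.sum_congr rfl fun k _ => ?_
    rw [Matrix.mulVec, dotProduct, Finset.mul_sum]
    exact Finset.sum_congr rfl fun l _ => by simp only [star_trivial]; ring

/-- An average over points of S is at most the supremum over S; this is the step that makes the
result one-sided. -/
lemma AvgNear.curvatureExcessLE {n : ℕ} {μ : Measure (Eucl n)} [IsProbabilityMeasure μ]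
    {t b : ℝ} {x : Eucl n} {w : Fin 4 → Fin n → ℝ} {G G' : Eucl n → Matrix (Fin n) (Fin n) ℝ}
    (h : AvgNear μ t x b (riem G' x w) (fun y => riem G y w)) {S : Set (Eucl n)}
    (hS : ∀ᵐ z ∂μ, x - t • z ∈ S) (hb : BddAbove ((fun y => riem G y w) '' S)) :
    CurvatureExcessLE G' G x S w b := by
  refine ⟨hb, ?_⟩
  have h1 : avg μ t (fun y => riem G y w) x ≤ sSup ((fun y => riem G y w) '' S) := by
    have h2 : ∫ z, riem G (x - t • z) w ∂μ
        ≤ ∫ _z, sSup ((fun y => riem G y w) '' S) ∂μ := by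
      refine integral_mono_ae h.integrable (integrable_const _) ?_
      filter_upwards [hS] with z hz
      exact le_csSup hb ⟨_, hz, rfl⟩
    simpa [avg] using h2
  have h3 := (abs_le.1 h.abs_sub).2
  linarith

lemma openCube_subset_ball {n : ℕ} {x : Eucl n} {s R : ℝ} (h : ‖x‖ + n * s < R) :
    openCube x s ⊆ ball 0 R := by
  intro y hy
  have h1 := dist_le_of_mem_openCube hy
  have h2 := dist_triangle y x 0
  rw [dist_zero_right x] at h2
  rw [mem_ball]
  linarith

lemma ball_subset_openCube {n : ℕ} (x : Eucl n) (t : ℝ) : ball x t ⊆ openCube x t := by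
  intro y hy i
  rw [mem_ball, dist_eq_norm] at hy
  exact (PiLp.norm_apply_le (y - x) i).trans_lt hy

/-- The curvature estimate in coordinates in positive dimension. -/
theorem exists_curvatureExcessLE (n : ℕ) (hn : 0 < n) {p r Q β : ℝ} (hp : 2 * (n : ℝ) < p)
    (hr : 0 < r) (hQ : 0 < Q) (hβ : β < 1 - n / p) :
    ∃ T : ℝ, 0 < T ∧ T < r / 2 ∧ ∃ C : ℝ, 0 < C ∧
      ∀ φ : Eucl n → ℝ, IsMollificationKernel φ →
      ∀ G : Eucl n → Matrix (Fin n) (Fin n) ℝ, (∀ x i j, G x i j = G x j i) →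
      (∀ a b, ContDiffOn ℝ ∞ (fun x => G x a b) (ball (0 : Eucl n) r)) →
      SobolevChartNormLE 2 p r Q G →
      ∀ t : ℝ, 0 < t → t ≤ T →
        (∀ a b, ContDiffOn ℝ ∞ (fun x => mollifyMetric φ r t G x a b)
          (ball (0 : Eucl n) (r / 2))) ∧
        (∀ x ∈ ball (0 : Eucl n) (r / 2), (mollifyMetric φ r t G x).PosDef) ∧
        ∀ x ∈ ball (0 : Eucl n) (r / 2), ∀ (w : Fin 4 → Fin n → ℝ) (V : ℝ), ‖w‖ ≤ V →
          CurvatureExcessLE (mollifyMetric φ r t G) G x (openCube x t) w (C * V ^ 4 * t ^ β) ∧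
          (Function.support φ ⊆ closedBall (0 : Eucl n) 1 →
            CurvatureExcessLE (mollifyMetric φ r t G) G x (ball x t) w (C * V ^ 4 * t ^ β)) := by
  have hn1 : (1 : ℝ) ≤ n := by exact_mod_cast hn
  -- A cube of half-width T stays within nT ≤ r/8 of its centre. Two nested cubes starting from |x|
  -- < r/2 thus stay within 3r/4, inside the ball of radius 7r/8; T ≤ 1 allows powers of t to be
  -- compared.
  set T : ℝ := min 1 (r / (8 * n)) with hT
  have hT0 : 0 < T := by positivity
  have hT1 : T ≤ 1 := min_le_left _ _
  have hTr : n * T ≤ r / 8 := by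
    have h1 : T ≤ r / (8 * n) := min_le_right _ _
    calc n * T ≤ n * (r / (8 * n)) := by gcongr
      _ = r / 8 := by field_simp
  have hTr' : T ≤ r / 8 := le_trans (by nlinarith) hTr
  obtain ⟨C, hC0, hC⟩ := MetricBounds.exists_avgNear_riem n (p := p)
    (K₀ := r ^ ((n : ℝ) / p - 1) * Q + r ^ ((n : ℝ) / p - 2) * Q) (c := Real.exp (-2 * Q)) (T := T)
    (by linarith) (by linarith) (by positivity) (Real.exp_pos _) hT0 hT1
  -- C is only known to be nonnegative; adding 1 makes the constant positive.
  refine ⟨T, hT0, by linarith, C + 1, by linarith, ?_⟩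
  intro φ hφ G hGsymm hGs hG t ht htT
  obtain ⟨F, hF, hFG⟩ := exists_metricBounds hr hQ.le hGs hG
  have := hφ.isProbabilityMeasure
  have hsub : ball (0 : Eucl n) (7 * r / 8) ⊆ ball 0 r := ball_subset_ball (by linarith)
  have hnt : n * t ≤ r / 8 := le_trans (by gcongr) hTr
  have hcube : ∀ x ∈ ball (0 : Eucl n) (r / 2), openCube x t ⊆ ball 0 (3 * r / 4) := by
    intro x hx
    rw [mem_ball_zero_iff] at hx
    exact openCube_subset_ball (by linarith)
  have h34 : closedBall (0 : Eucl n) (3 * r / 4) ⊆ ball 0 (7 * r / 8) :=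
    closedBall_subset_ball (by linarith)
  have hcube' : ∀ x ∈ ball (0 : Eucl n) (r / 2), openCube x t ⊆ ball 0 (7 * r / 8) := fun x hx =>
    (hcube x hx).trans (ball_subset_closedBall.trans h34)
  have hmoll : ∀ x ∈ ball (0 : Eucl n) (r / 2),
      mollifyMetric φ r t G x = avgMetric (kernelMeasure φ) t F x := fun x hx =>
    hφ.mollifyMetric_eq_avgMetric ht hsub hFG (hcube' x hx)
  have hriem : ∀ y ∈ ball (0 : Eucl n) (7 * r / 8), ∀ w, riem F y w = riem G y w :=
    fun y hy w => riem_congr (by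
      filter_upwards [isOpen_ball.mem_nhds hy] with z hz
      exact hFG z hz) w
  refine ⟨fun a b => ?_, fun x hx => ?_, fun x hx w V hwV => ?_⟩
  · refine (hφ.contDiff_avg ht (hF.contDiff a b) (hF.hasCompactSupport a b)).contDiffOn.congr
      fun x hx => ?_
    rw [hmoll x hx]
    rfl
  · refine posDef_of_lower_bound (Real.exp_pos (-2 * Q)) (fun i j => ?_) ?_
    · simp only [mollifyMetric, Matrix.of_apply, hGsymm _ i j]
    · rw [hmoll x hx]
      exact hF.lower_avgMetric hφ.ae_mem_openCube ht (hcube' x hx)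
  · have hw : ∀ i j, |w i j| ≤ V := fun i j =>
      (norm_le_pi_norm (w i) j).trans ((norm_le_pi_norm w i).trans hwV)
    have hV : 0 ≤ V := (norm_nonneg w).trans hwV
    have hxT : ∀ y ∈ openCube x T, openCube y T ⊆ ball 0 (7 * r / 8) := by
      intro y hy
      rw [mem_ball_zero_iff] at hx
      have h1 := openCube_subset_ball (x := x) (s := T) (R := 5 * r / 8) (by linarith) hy
      rw [mem_ball_zero_iff] at h1
      exact openCube_subset_ball (by linarith)
    have h1 := hC (kernelMeasure φ) hφ.kernelMeasure_le hφ.ae_mem_openCube _ F hF x hxT t ht htT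
      w V hw
    have h2 : riem (avgMetric (kernelMeasure φ) t F) x w = riem (mollifyMetric φ r t G) x w :=
      riem_congr (by
        filter_upwards [isOpen_ball.mem_nhds hx] with z hz
        exact (hmoll z hz).symm) w
    have h3 : C * V ^ 4 * t ^ (1 - n / p : ℝ) ≤ (C + 1) * V ^ 4 * t ^ β := by
      have h4 : t ^ (1 - n / p : ℝ) ≤ t ^ β :=
        Real.rpow_le_rpow_of_exponent_ge ht (htT.trans hT1) hβ.le
      gcongr
      linarith
    have h4 := (h1.congr hφ.ae_mem_openCube ht h2
      (fun y hy => hriem y (hcube' x hx hy) w)).mono h3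
    -- The supremum is finite because the cube lies in a compact ball on which the curvature is
    -- continuous.
    have hbdd : BddAbove ((fun y => riem G y w) '' openCube x t) := by
      have h5 := ((isCompact_closedBall (0 : Eucl n) (3 * r / 4)).image_of_continuousOn
        ((hF.continuousOn_riem (Real.exp_pos _) w).mono h34)).bddAbove
      refine h5.mono ?_
      rintro _ ⟨y, hy, rfl⟩
      exact ⟨y, ball_subset_closedBall (hcube x hx hy), hriem y (hcube' x hx hy) w⟩
    refine ⟨h4.curvatureExcessLE ?_ hbdd, fun hsupp => h4.curvatureExcessLE ?_
      (hbdd.mono (image_mono (ball_subset_openCube x t)))⟩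
    · filter_upwards [hφ.ae_mem_openCube] with z hz
      exact sub_smul_mem_openCube ht hz
    · filter_upwards [hφ.ae_mem_ball hsupp] with z hz
      rw [mem_ball_zero_iff] at hz
      rw [mem_ball, dist_eq_norm, sub_sub_cancel_left, norm_neg, norm_smul, Real.norm_eq_abs,
        abs_of_pos ht]
      nlinarith

lemma curvatureExcessLE_zero_dim {G G' : Eucl 0 → Matrix (Fin 0) (Fin 0) ℝ} (x : Eucl 0)
    (S : Set (Eucl 0)) (w : Fin 4 → Fin 0 → ℝ) {b : ℝ} (hb : 0 ≤ b) :
    CurvatureExcessLE G' G x S w b := by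
  have h1 : ∀ G y, riem G y w = 0 := fun G y => by simp [riem]
  refine ⟨⟨0, ?_⟩, ?_⟩
  · rintro _ ⟨y, _, rfl⟩
    exact (h1 G y).le
  · have h2 : 0 ≤ sSup ((fun y => riem G y w) '' S) := by
      -- This covers empty S as well, where the real supremum is 0.
      refine Real.sSup_nonneg ?_
      rintro _ ⟨y, _, rfl⟩
      exact (h1 G y).ge
    rw [h1]
    linarith

end MollifiedCurvature

open MollifiedCurvature in
theorem mainTheorem3 (n : ℕ) (p r Q β : ℝ) (hp : 2 * (n : ℝ) < p) (hr : 0 < r) (hQ : 0 < Q)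
    (hβ : 1 / 2 < β) (hβ' : β < 1 - n / p) :
    ∃ T : ℝ, 0 < T ∧ T < r / 2 ∧ ∃ C : ℝ, 0 < C ∧
      ∀ φ : Eucl n → ℝ, IsMollificationKernel φ →
      ∀ (M : Type*) [TopologicalSpace M] [ChartedSpace (Eucl n) M]
        [IsManifold 𝓘(ℝ, Eucl n) ∞ M] (g : SmoothMetric n M) (x₀ : M)
        (ψ : OpenPartialHomeomorph (Eucl n) M), IsPointedChart r x₀ ψ →
      SobolevChartNormLE 2 p r Q (pullbackMetric g ψ) →
      ∀ t : ℝ, 0 < t → t ≤ T →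
        -- the mollified coordinate metric is a smooth Riemannian metric on `B(0, r/2)`
        (∀ a b, ContDiffOn ℝ ∞ (fun x => mollifyMetric φ r t (pullbackMetric g ψ) x a b)
          (ball (0 : Eucl n) (r / 2))) ∧
        (∀ x ∈ ball (0 : Eucl n) (r / 2),
          (mollifyMetric φ r t (pullbackMetric g ψ) x).PosDef) ∧
        -- the curvature estimate, for a bounded smooth section `v`
        ∀ v : Eucl n → Fin 4 → Fin n → ℝ, ContDiffOn ℝ ∞ v (ball (0 : Eucl n) r) →
          MemLp v ∞ (volume.restrict (ball (0 : Eucl n) r)) →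
          ∀ x ∈ ball (0 : Eucl n) (r / 2),
            CurvatureExcessLE (mollifyMetric φ r t (pullbackMetric g ψ)) (pullbackMetric g ψ) x
              (openCube x t) (v x)
              (C * (eLpNorm v ∞ (volume.restrict (ball (0 : Eucl n) r))).toReal ^ 4 * t ^ β) ∧
            (Function.support φ ⊆ closedBall (0 : Eucl n) 1 →
              CurvatureExcessLE (mollifyMetric φ r t (pullbackMetric g ψ)) (pullbackMetric g ψ) x
                (ball x t) (v x)
                (C * (eLpNorm v ∞ (volume.restrict (ball (0 : Eucl n) r))).toReal ^ 4
                  * t ^ β)) := by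
  -- In dimension 0 all curvature sums are empty, and the scale r/(8n) of the general case would be
  -- 0.
  rcases Nat.eq_zero_or_pos n with rfl | hn
  · refine ⟨r / 4, by linarith, by linarith, 1, one_pos, ?_⟩
    intro φ _ M _ _ _ g x₀ ψ _ _ t ht _
    refine ⟨fun a => a.elim0, fun x _ => posDef_of_lower_bound one_pos (fun i => i.elim0)
      fun v => ?_, fun v _ _ x _ => ?_⟩
    · simp [Subsingleton.elim v 0]
    · exact ⟨curvatureExcessLE_zero_dim _ _ _ (by positivity),
        fun _ => curvatureExcessLE_zero_dim _ _ _ (by positivity)⟩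
  · obtain ⟨T, hT0, hTr, C, hC0, h⟩ := exists_curvatureExcessLE n hn hp hr hQ hβ'
    refine ⟨T, hT0, hTr, C, hC0, ?_⟩
    intro φ hφ M _ _ _ g x₀ ψ hψ hG t ht htT
    obtain ⟨h1, h2, h3⟩ := h φ hφ (pullbackMetric g ψ) (pullbackMetric_symm g ψ)
      (contDiffOn_pullbackMetric g hψ) hG t ht htT
    refine ⟨h1, h2, fun v hv hv' x hx => h3 x hx (v x) _ ?_⟩
    exact norm_le_toReal_eLpNorm_top isOpen_ball hv.continuousOn hv'
      (ball_subset_ball (by linarith) hx)
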